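/- **Setting.** Let $b:\mathbb R^d\to\mathbb R^d$ and $\sigma:\mathbb R^d\to\mathbb R^{d\times d}$ be Lipschitz continuous, and let $\rho_t(x,\cdot)$ $(t\ge 0)$ be the transition kernel of the stochastic differential equation $dX_t=b(X_t)\,dt+\sigma(X_t)\,dW_t$, i.e. $\rho_t(x,\cdot)$ is the law of $X_t$ for the solution started at $x$. Let $\mathcal X=\overline D$, where $D\subset\mathbb R^d$ is open, bounded and connected, let $\mathcal Y\supset\mathcal X$ be a closed set with $\rho_t(x,\mathcal Y)=1$ for all $t\ge0$, $x\in\mathcal X$, let $T>0$, and let $\mu$ be a finite Borel measure on $\mathcal Y$ with $\mu(\mathcal X)=1$ such that, for some constant $L>0$, $\int_{\mathcal X}\rho_t(x,A)\,d\mu(x)\le L\,\mu(A)$ for all Borel sets $A\subset\mathcal Y$ and all $t\in[0,T]$. Let $k:\mathcal Y\times\mathcal Y\to\mathbb R$ be a continuous, bounded, symmetric positive definite kernel, $\varphi(x)=k(x,x)$, and let $\mathbb H_{\mathcal Y}$, $\mathbb H_{\mathcal X}$ be the reproducing kernel Hilbert spaces generated by $k$ and by its restriction to $\mathcal X\times\mathcal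 X$, with feature maps $\Phi(x)=k(x,\cdot)$. Assume: (C1) if $\psi\in L^2(\mathcal Y;\mu)$ and $\int_{\mathcal Y}\int_{\mathcal Y}k(x,y)\psi(x)\psi(y)\,d\mu(x)\,d\mu(y)=0$, then $\psi=0$ $\mu$-a.e.; (C2) if $\psi\in\mathbb H_{\mathcal Y}$ vanishes $\mu$-a.e. on $\mathcal Y$, then $\psi=0$; and if $\psi\in\mathbb H_{\mathcal X}$ vanishes $\mu$-a.e. on $\mathcal X$, then $\psi=0$. Let $S:\mathbb H_{\mathcal X}\to L^2(\mathcal X;\mu)$ be the inclusion (injective by (C2); we regard $\mathbb H_{\mathcal X}$ as a subspace of $L^2(\mathcal X;\mu)$), let $C_{\mathcal X}=S^*S$ be the covariance operator, and let $\lambda_1\ge\lambda_2\ge\dots\ge 0$ be its eigenvalues, counted with multiplicity (with $\lambda_j=0$ if $C_{\mathcal X}$ has fewer than $j$ positive eigenvalues). For $t\in[0,T]$ let $(K^t\psi)(x)=\int_{\mathcal Y}\psi(y)\,\rho_t(x,dy)$, $x\in\mathcal X$, be the Koopman operator, considered as an operator $\mathbb H_{\mathcal Y}\to L^2(\mathcal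 X;\mu)$. For data $(x_i,y_i)\in\mathcal X\times\mathcal Y$, $i=0,\dots,m-1$, put $$\widehat C_{\mathcal X}^m=\frac1m\sum_{i}\Phi(x_i)\otimes\Phi(x_i),\qquad \widehat C_{\mathcal X\mathcal Y}^{m,t}=\frac1m\sum_{i}\Phi(x_i)\otimes\Phi(y_i),\qquad \widehat K_r^{m,t}=[\widehat C_{\mathcal X}^m]_r^\dagger\,\widehat C_{\mathcal X\mathcal Y}^{m,t},$$ where $(\Phi(x)\otimes\Phi(y))\psi=\psi(y)\Phi(x)$ and $[\widehat C]_r^\dagger=\sum_{j=1}^r\widehat\lambda_j^{-1}\langle\,\cdot\,,\widehat f_j\rangle\widehat f_j$ with orthonormal eigenvectors $\widehat f_j$ belonging to the $r$ largest eigenvalues $\widehat\lambda_1\ge\dots\ge\widehat\lambda_r$ of $\widehat C$ (terms with $\widehat\lambda_j=0$ are omitted). **Theorem.** Let $r\ge1$, assume $\lambda_{j+1}<\lambda_j$ for $j=1,\dots,r$, and let $$\delta_r=\min_{j=1,\dots,r}\frac{\lambda_j-\lambda_{j+1}}2,\qquad c_r=\frac1{\sqrt{\lambda_r}}+\frac{r+1}{\delta_r\lambda_r}\bigl(1+\|\varphi\|_{L^1(\mathcal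 Y;\mu)}\bigr)\|\varphi\|_{L^1(\mathcal X;\mu)}^{1/2}.$$ Let $P_r$ be the orthogonal projection in $L^2(\mathcal X;\mu)$ onto the span of the eigenvectors of $SS^*$ belonging to $\lambda_1,\dots,\lambda_r$. Let $\varepsilon\in(0,\delta_r)$, $\delta\in(0,1)$, $t\in[0,T]$, let $m\in\mathbb N$ with $m\ge\max\{r,\,8\|k\|_\infty^2\ln(4/\delta)/\varepsilon^2\}$, and let $(x_i,y_i)$, $i=0,\dots,m-1$, be i.i.d. with law $\rho_t(x,dy)\,d\mu(x)$ on $\mathcal X\times\mathcal Y$. Then, with probability at least $1-\delta$, estimators $\widehat K_r^{m,t}$ exist and each of them satisfies $$\|P_rK^t-\widehat K_r^{m,t}\|_{\mathbb H_{\mathcal Y}\to L^2(\mathcal X;\mu)}\le c_r\varepsilon .$$ If, moreover, $K^t\mathbb H_{\mathcal Y}\subset\mathbb H_{\mathcal X}$, then $K^t$ is bounded from $\mathbb H_{\mathcal Y}$ to $\mathbb H_{\mathcal X}$ and, with probability at least $1-\delta$, $$\|K^t-\widehat K_r^{m,t}\|_{\mathbb H_{\mathcal Y}\to L^2(\mathcal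 X;\mu)}\le\sqrt{\lambda_{r+1}}\,\|K^t\|_{\mathbb H_{\mathcal Y}\to\mathbb H_{\mathcal X}}+c_r\varepsilon$$ for each such estimator. -/

import Mathlib

open MeasureTheory ProbabilityTheory Filter Topology Set
open scoped NNReal ENNReal

noncomputable section

namespace KernelEDMD

/-! ### Stochastic differential equations -/

/-- The Euclidean space `ℝ^d`. -/
abbrev Euc (d : ℕ) : Type := EuclideanSpace ℝ (Fin d)

/-- `W` is a `d`-dimensional standard Brownian motion relative to the filtration `𝓕`: it is
adapted, its coordinates are independent real Brownian motions, and the increment `W t - W s` is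
independent of the past `𝓕 s`. -/
structure IsBrownianMotion {d : ℕ} {Ω : Type*} {mΩ : MeasurableSpace Ω} (P : Measure Ω)
    (𝓕 : Filtration ℝ≥0 mΩ) (W : ℝ≥0 → Ω → Euc d) : Prop where
  adapted : Adapted 𝓕 W
  coord : ∀ i, IsBrownianReal (fun t ω => W t ω i) P
  indep_coord : iIndepFun (fun (i : Fin d) (ω : Ω) (t : ℝ≥0) => W t ω i) P
  indep_past : ∀ s t, s ≤ t →
    Indep (MeasurableSpace.comap (fun ω => W t ω - W s ω) inferInstance) (𝓕 s) P

/-- The left-endpoint Riemann sum of `∫₀ᵗ σ(X_s) dW_s` over `n` subintervals of equal length. -/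
def itoSum {d : ℕ} {Ω : Type*} (σ : Euc d → Euc d →L[ℝ] Euc d)
    (W X : ℝ≥0 → Ω → Euc d) (t : ℝ≥0) (n : ℕ) (ω : Ω) : Euc d :=
  ∑ i ∈ Finset.range n, σ (X (t * i / n) ω) (W (t * (i + 1) / n) ω - W (t * i / n) ω)

/-- `X` solves `dX_t = b(X_t) dt + σ(X_t) dW_t`: it is adapted with a.s. continuous paths, and
`X_t - X_0 - ∫₀ᵗ b(X_s) ds = ∫₀ᵗ σ(X_s) dW_s` for all `t`. The Itô integral of the continuous adapted
process `σ(X_s)` is the limit in probability of its left-endpoint Riemann sums.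
The matrix `σ(x)` is regarded as a linear map of `ℝ^d`. -/
structure IsSDESolution {d : ℕ} (b : Euc d → Euc d) (σ : Euc d → Euc d →L[ℝ] Euc d)
    {Ω : Type*} {mΩ : MeasurableSpace Ω} (P : Measure Ω)
    (𝓕 : Filtration ℝ≥0 mΩ) (W X : ℝ≥0 → Ω → Euc d) : Prop where
  brownian : IsBrownianMotion P 𝓕 W
  adapted : Adapted 𝓕 X
  continuous_paths : ∀ᵐ ω ∂P, Continuous fun t => X t ω
  equation : ∀ t : ℝ≥0, TendstoInMeasure P (fun n => itoSum σ W X t n) atTop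
    (fun ω => X t ω - X 0 ω - ∫ s in (0 : ℝ)..t, b (X s.toNNReal ω))

/-- `ρ_t(x, ·)` is the law at time `t` of the solution of the stochastic differential equation
started at `x`. (For Lipschitz coefficients this law exists and is unique.) -/
def IsTransitionKernel {d : ℕ} (b : Euc d → Euc d) (σ : Euc d → Euc d →L[ℝ] Euc d)
    (ρ : ℝ≥0 → Kernel (Euc d) (Euc d)) : Prop :=
  ∀ x : Euc d, ∃ (Ω : Type) (mΩ : MeasurableSpace Ω) (P : Measure Ω) (𝓕 : Filtration ℝ≥0 mΩ)
    (W X : ℝ≥0 → Ω → Euc d), IsProbabilityMeasure P ∧ IsSDESolution b σ P 𝓕 W X ∧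
      (∀ᵐ ω ∂P, X 0 ω = x) ∧ ∀ t, P.map (X t) = ρ t x

/-! ### Restriction to the state sets -/

section Restriction

variable {d : ℕ} {𝒳 𝒴 : Set (Euc d)}

/-- The restriction to `𝒳` of a measure on `𝒴 ⊇ 𝒳`. -/
def restrictMeasure (h : 𝒳 ⊆ 𝒴) (μ : Measure 𝒴) : Measure 𝒳 := μ.comap (Set.inclusion h)

instance (h : 𝒳 ⊆ 𝒴) (μ : Measure 𝒴) [IsFiniteMeasure μ] :
    IsFiniteMeasure (restrictMeasure h μ) := by
  unfold restrictMeasure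
  infer_instance

/-- The kernel `(x, A) ↦ ρ(x, A)` for `x ∈ 𝒳` and Borel sets `A ⊆ 𝒴`. -/
def restrictKernel (𝒳 : Set (Euc d)) (h𝒴 : IsClosed 𝒴) (ρ : Kernel (Euc d) (Euc d)) :
    Kernel 𝒳 𝒴 :=
  (ρ.comap Subtype.val measurable_subtype_coe).comapRight
    (MeasurableEmbedding.subtype_coe h𝒴.measurableSet)

instance (h𝒴 : IsClosed 𝒴) (ρ : Kernel (Euc d) (Euc d)) [IsFiniteKernel ρ] :
    IsFiniteKernel (restrictKernel 𝒳 h𝒴 ρ) := by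
  unfold restrictKernel
  infer_instance

/-- The restriction of `k` to `𝒳 × 𝒳`. -/
def restrictFun (h : 𝒳 ⊆ 𝒴) (k : 𝒴 → 𝒴 → ℝ) : 𝒳 → 𝒳 → ℝ :=
  fun x x' => k (Set.inclusion h x) (Set.inclusion h x')

end Restriction

/-! ### Kernels and reproducing kernel Hilbert spaces -/

/-- A continuous bounded symmetric positive definite kernel. -/
structure IsBoundedContinuousKernel {α : Type*} [TopologicalSpace α] (k : α → α → ℝ) : Prop where
  continuous : Continuous fun p : α × α => k p.1 p.2
  bounded : ∃ C, ∀ x y, |k x y| ≤ C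
  symm : ∀ x y, k x y = k y x
  nonneg : ∀ (n : ℕ) (x : Fin n → α) (c : Fin n → ℝ), 0 ≤ ∑ i, ∑ j, k (x i) (x j) * c i * c j

lemma IsBoundedContinuousKernel.restrict {d : ℕ} {𝒳 𝒴 : Set (Euc d)} {k : 𝒴 → 𝒴 → ℝ}
    (hk : IsBoundedContinuousKernel k) (h : 𝒳 ⊆ 𝒴) :
    IsBoundedContinuousKernel (restrictFun h k) where
  continuous := hk.continuous.comp
    (((continuous_inclusion h).comp continuous_fst).prodMk
      ((continuous_inclusion h).comp continuous_snd))
  bounded := hk.bounded.imp fun _ hC _ _ => hC _ _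
  symm _ _ := hk.symm _ _
  nonneg n x c := hk.nonneg n (fun i => Set.inclusion h (x i)) c

/-- The supremum norm `‖k‖_∞` of a bounded kernel. -/
def kernelSup {α : Type*} (k : α → α → ℝ) : ℝ := ⨆ p : α × α, |k p.1 p.2|

/-- The norm `‖φ‖_{1}` in `L¹(μ)` of the kernel diagonal `φ(x) = k(x, x)`. -/
def diagNorm {α : Type*} [MeasurableSpace α] (k : α → α → ℝ) (μ : Measure α) : ℝ :=
  ∫ x, |k x x| ∂μ

section RKHSpace

variable {α : Type*} (H : Type*) [NormedAddCommGroup H] [InnerProductSpace ℝ H] [CompleteSpace H]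
  [RKHS ℝ H α ℝ]

/-- `H` is the reproducing kernel Hilbert space generated by `k`. -/
def IsRKHSOf (k : α → α → ℝ) : Prop := ∀ x y, RKHS.kernel H x y 1 = k x y

/-- The feature map `Φ(x) = k(x, ·)`. -/
def feature (x : α) : H := RKHS.kerFun H x 1

variable {H}

lemma feature_inner (x : α) (f : H) : inner ℝ f (feature H x) = f x := by
  simp [feature]

lemma feature_inner_feature {k : α → α → ℝ} (hH : IsRKHSOf H k) (x y : α) :
    inner ℝ (feature H x) (feature H y) = k y x := by
  rw [feature_inner, feature, RKHS.kerFun_apply, hH]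

lemma norm_feature_sq {k : α → α → ℝ} (hH : IsRKHSOf H k) (x : α) :
    ‖feature H x‖ ^ 2 = k x x := by
  rw [← real_inner_self_eq_norm_sq, feature_inner_feature hH]

variable [TopologicalSpace α] {k : α → α → ℝ}

lemma exists_bound (hk : IsBoundedContinuousKernel k) (hH : IsRKHSOf H k) :
    ∃ C : ℝ, 0 ≤ C ∧ ∀ (f : H) (x : α), ‖f x‖ ≤ C * ‖f‖ := by
  obtain ⟨C, hC⟩ := hk.bounded
  refine ⟨√C, Real.sqrt_nonneg _, fun f x => ?_⟩
  have h1 : ‖feature H x‖ ≤ √C :=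
    Real.le_sqrt_of_sq_le (by rw [norm_feature_sq hH]; exact (le_abs_self _).trans (hC x x))
  calc ‖f x‖ = ‖inner ℝ f (feature H x)‖ := by rw [feature_inner]
    _ ≤ ‖f‖ * ‖feature H x‖ := norm_inner_le_norm _ _
    _ ≤ √C * ‖f‖ := by rw [mul_comm]; gcongr

lemma continuous_feature (hk : IsBoundedContinuousKernel k) (hH : IsRKHSOf H k) :
    Continuous (feature H : α → H) := by
  have hsq : ∀ x y : α, ‖feature H x - feature H y‖ ^ 2 = k x x - 2 * k x y + k y y := by
    intro x y
    rw [norm_sub_sq_real, norm_feature_sq hH, norm_feature_sq hH, feature_inner_feature hH,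
      hk.symm y x]
  refine continuous_iff_continuousAt.2 fun y => ?_
  rw [ContinuousAt, tendsto_iff_norm_sub_tendsto_zero]
  have hc : Continuous fun x => √(k x x - 2 * k x y + k y y) := by
    have h1 : Continuous fun x => k x x := hk.continuous.comp (continuous_id.prodMk continuous_id)
    have h2 : Continuous fun x => k x y := hk.continuous.comp (continuous_id.prodMk continuous_const)
    exact ((h1.sub (continuous_const.mul h2)).add continuous_const).sqrt
  have h0 : √(k y y - 2 * k y y + k y y) = 0 := by
    rw [show k y y - 2 * k y y + k y y = 0 by ring, Real.sqrt_zero]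
  have h3 := hc.tendsto y
  rw [h0] at h3
  refine h3.congr fun x => ?_
  rw [← hsq, Real.sqrt_sq (norm_nonneg _)]

lemma continuous_coe (hk : IsBoundedContinuousKernel k) (hH : IsRKHSOf H k) (f : H) :
    Continuous (f : α → ℝ) := by
  have : (f : α → ℝ) = fun x => inner ℝ f (feature H x) := by
    ext x; rw [feature_inner]
  rw [this]
  exact continuous_const.inner (continuous_feature hk hH)

variable [MeasurableSpace α] {β : Type*} [MeasurableSpace β]

lemma koopman_bound (hk : IsBoundedContinuousKernel k) (hH : IsRKHSOf H k)
    (κ : Kernel β α) [IsFiniteKernel κ] :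
    ∃ C : ℝ, 0 ≤ C ∧ ∀ (f : H) (x : β), ‖∫ y, f y ∂(κ x)‖ ≤ C * ‖f‖ := by
  obtain ⟨C, hC0, hC⟩ := exists_bound hk hH
  refine ⟨C * (κ.bound).toReal, by positivity, fun f x => ?_⟩
  have h1 := norm_integral_le_of_norm_le_const (μ := κ x) (ae_of_all _ (hC f))
  have h2 : (κ x).real univ ≤ (κ.bound).toReal :=
    ENNReal.toReal_mono (Kernel.bound_ne_top κ) (Kernel.measure_le_bound κ x univ)
  calc _ ≤ C * ‖f‖ * (κ x).real univ := h1
    _ ≤ C * ‖f‖ * (κ.bound).toReal := by gcongr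
    _ = _ := by ring

variable [BorelSpace α]

lemma memLp_coe (hk : IsBoundedContinuousKernel k) (hH : IsRKHSOf H k) (μ : Measure α)
    [IsFiniteMeasure μ] (f : H) : MemLp (f : α → ℝ) 2 μ := by
  obtain ⟨C, -, hC⟩ := exists_bound hk hH
  exact MemLp.of_bound (continuous_coe hk hH f).measurable.aestronglyMeasurable (C * ‖f‖)
    (ae_of_all _ (hC f))

/-- The inclusion operator `S : H → L²(μ)`, `S ψ = [ψ]`. -/
def inclusion (hk : IsBoundedContinuousKernel k) (hH : IsRKHSOf H k) (μ : Measure α)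
    [IsFiniteMeasure μ] : H →L[ℝ] Lp ℝ 2 μ :=
  LinearMap.mkContinuousOfExistsBound
    { toFun := fun f => (memLp_coe hk hH μ f).toLp f
      map_add' := fun f g => by
        rw [← MemLp.toLp_add]
        exact MemLp.toLp_congr _ _ (by rw [RKHS.coe_add])
      map_smul' := fun c f => by
        rw [RingHom.id_apply, ← MemLp.toLp_const_smul]
        exact MemLp.toLp_congr _ _ (by rw [RKHS.coe_smul]) }
    (by
      obtain ⟨C, hC0, hC⟩ := exists_bound hk hH
      refine ⟨(measureUnivNNReal μ : ℝ) ^ (2 : ℝ≥0∞).toReal⁻¹ * C, fun f => ?_⟩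
      have h := Lp.norm_le_of_ae_bound (f := (memLp_coe hk hH μ f).toLp f)
        (mul_nonneg hC0 (norm_nonneg f))
        (by
          filter_upwards [(memLp_coe hk hH μ f).coeFn_toLp] with x hx
          rw [hx]; exact hC f x)
      rw [mul_assoc]
      exact h)

lemma integrable_coe (hk : IsBoundedContinuousKernel k) (hH : IsRKHSOf H k) (μ : Measure α)
    [IsFiniteMeasure μ] (f : H) : Integrable (f : α → ℝ) μ :=
  (memLp_coe hk hH μ f).integrable (by norm_num)

lemma memLp_koopman (hk : IsBoundedContinuousKernel k) (hH : IsRKHSOf H k)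
    (κ : Kernel β α) [IsFiniteKernel κ] (ν : Measure β) [IsFiniteMeasure ν] (f : H) :
    MemLp (fun x => ∫ y, f y ∂(κ x)) 2 ν := by
  obtain ⟨C, -, hC⟩ := koopman_bound hk hH κ
  have hm : StronglyMeasurable (f : α → ℝ) := (continuous_coe hk hH f).measurable.stronglyMeasurable
  exact MemLp.of_bound hm.integral_kernel.aestronglyMeasurable (C * ‖f‖) (ae_of_all _ (hC f))

/-- The Koopman operator `(K ψ)(x) = ∫ ψ(y) κ(x, dy)`, as an operator from the reproducing kernel
Hilbert space `H` of functions on `α` to `L²(ν)`. -/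
def koopman (hk : IsBoundedContinuousKernel k) (hH : IsRKHSOf H k)
    (κ : Kernel β α) [IsFiniteKernel κ] (ν : Measure β) [IsFiniteMeasure ν] :
    H →L[ℝ] Lp ℝ 2 ν :=
  LinearMap.mkContinuousOfExistsBound
    { toFun := fun f => (memLp_koopman hk hH κ ν f).toLp (fun x => ∫ y, f y ∂(κ x))
      map_add' := fun f g => by
        rw [← MemLp.toLp_add]
        refine MemLp.toLp_congr _ _ (ae_of_all _ fun x => ?_)
        simp only [RKHS.coe_add, Pi.add_apply]
        exact integral_add (integrable_coe hk hH _ f) (integrable_coe hk hH _ g)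
      map_smul' := fun c f => by
        rw [RingHom.id_apply, ← MemLp.toLp_const_smul]
        refine MemLp.toLp_congr _ _ (ae_of_all _ fun x => ?_)
        simp only [RKHS.coe_smul, Pi.smul_apply]
        exact integral_smul c _ }
    (by
      obtain ⟨C, hC0, hC⟩ := koopman_bound hk hH κ
      refine ⟨(measureUnivNNReal ν : ℝ) ^ (2 : ℝ≥0∞).toReal⁻¹ * C, fun f => ?_⟩
      have h := Lp.norm_le_of_ae_bound
        (f := (memLp_koopman hk hH κ ν f).toLp (fun x => ∫ y, f y ∂(κ x)))
        (mul_nonneg hC0 (norm_nonneg f))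
        (by
          filter_upwards [(memLp_koopman hk hH κ ν f).coeFn_toLp] with x hx
          rw [hx]; exact hC f x)
      rw [mul_assoc]
      exact h)

end RKHSpace

/-! ### Leading eigenvalues, spectral projections, truncated pseudo-inverses -/

section Spectral

variable {E : Type*} [NormedAddCommGroup E] [InnerProductSpace ℝ E]

/-- The span of all eigenvectors of `T` with eigenvalue at least `a`. -/
def eigenspaceGE (T : E →L[ℝ] E) (a : ℝ) : Submodule ℝ E :=
  ⨆ s ∈ Set.Ici a, Module.End.eigenspace (T : E →ₗ[ℝ] E) s

/-- The `j`-th largest eigenvalue (`j = 1, 2, …`, counted with multiplicity) of a compact positive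
self-adjoint operator `T`: the largest `a > 0` such that the eigenvectors with eigenvalue at least
`a` span a space of dimension at least `j`, and `0` if there is none. -/
def eigVal (T : E →L[ℝ] E) (j : ℕ) : ℝ :=
  sSup {a : ℝ | 0 < a ∧ (j : Cardinal) ≤ Module.rank ℝ (eigenspaceGE T a)}

/-- `f 0, …, f (r-1)` are orthonormal eigenvectors of `T` belonging to its `r` largest
eigenvalues. -/
structure IsLeadingEigensystem (T : E →L[ℝ] E) (r : ℕ) (f : Fin r → E) : Prop where
  orthonormal : Orthonormal ℝ f
  eigen : ∀ j, T (f j) = eigVal T (j + 1) • f j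

/-- `A` is the pseudo-inverse `[T]_r^†` of a rank-`r` eigendecomposition truncation of `T`, that is
`A ψ = ∑_j λ_j⁻¹ ⟨f_j, ψ⟩ f_j` over leading eigenpairs `(λ_j, f_j)`, `j = 1, …, r` (as usual for
pseudo-inverses, a zero eigenvalue contributes nothing). -/
def IsTruncatedPinv (T : E →L[ℝ] E) (r : ℕ) (A : E →L[ℝ] E) : Prop :=
  ∃ f : Fin r → E, IsLeadingEigensystem T r f ∧
    A = ∑ j : Fin r, (eigVal T (j + 1))⁻¹ • InnerProductSpace.rankOne ℝ (f j) (f j)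

variable {F : Type*} [NormedAddCommGroup F] [InnerProductSpace ℝ F] [CompleteSpace E]
  [CompleteSpace F]

/-- The covariance operator `C = S^* S`. -/
def covOp (S : E →L[ℝ] F) : E →L[ℝ] E := S.adjoint ∘L S

/-- The orthogonal projection `P_r` onto the (closed) span of the eigenvectors of `S S^*` belonging
to the `r` largest eigenvalues of `C = S^* S`. -/
def mercerProj (S : E →L[ℝ] F) (r : ℕ) : F →L[ℝ] F :=
  (eigenspaceGE (S ∘L S.adjoint) (eigVal (covOp S) r)).topologicalClosure.starProjection

end Spectral

/-! ### The constants -/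

/-- `δ_r = min_{1 ≤ j ≤ r} (λ_j - λ_{j+1}) / 2`. -/
def gap (ev : ℕ → ℝ) (r : ℕ) : ℝ := ⨅ j : Fin r, (ev (j + 1) - ev (j + 2)) / 2

/-- `c_r = 1/√λ_r + (r+1)/(δ_r λ_r) (1 + ‖φ‖_{1,𝒴}) ‖φ‖_{1,𝒳}^{1/2}`, where
`nY = ‖φ‖_{1,𝒴}` and `nX = ‖φ‖_{1,𝒳}`. -/
def errorConst (ev : ℕ → ℝ) (r : ℕ) (nX nY : ℝ) : ℝ :=
  1 / √(ev r) + (r + 1) / (gap ev r * ev r) * (1 + nY) * √nX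

/-! ### The estimator -/

section Estimator

variable {α β : Type*} (HX HY : Type*)
  [NormedAddCommGroup HX] [InnerProductSpace ℝ HX] [CompleteSpace HX] [RKHS ℝ HX α ℝ]
  [NormedAddCommGroup HY] [InnerProductSpace ℝ HY] [CompleteSpace HY] [RKHS ℝ HY β ℝ]

/-- The empirical covariance operator `(1/m) ∑ Φ(x_i) ⊗ Φ(x_i)`. -/
def empCov {m : ℕ} (z : Fin m → α × β) : HX →L[ℝ] HX :=
  (m : ℝ)⁻¹ • ∑ i, InnerProductSpace.rankOne ℝ (feature HX (z i).1) (feature HX (z i).1)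

/-- The empirical cross-covariance operator `(1/m) ∑ Φ(x_i) ⊗ Φ(y_i)`, where
`(Φ(x) ⊗ Φ(y)) ψ = ⟨ψ, Φ(y)⟩ Φ(x) = ψ(y) Φ(x)`. -/
def empCross {m : ℕ} (z : Fin m → α × β) : HY →L[ℝ] HX :=
  (m : ℝ)⁻¹ • ∑ i, InnerProductSpace.rankOne ℝ (feature HX (z i).1) (feature HY (z i).2)

variable {HX HY}

/-- `Khat = [Ĉ_X]_r^† Ĉ_XY` is a kEDMD estimator of truncation rank `r` computed from the data
`z i = (x_i, y_i)`. -/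
def IsKEDMDEstimator {m : ℕ} (z : Fin m → α × β) (r : ℕ) (Khat : HY →L[ℝ] HX) : Prop :=
  ∃ A : HX →L[ℝ] HX, IsTruncatedPinv (empCov HX z) r A ∧ Khat = A ∘L empCross HX HY z

end Estimator

/-- The event described by `Q` has probability at least `p`: it contains a measurable event of
probability at least `p`. -/
def HoldsWithProbGE {Ω : Type*} [MeasurableSpace Ω] (P : Measure Ω) (p : ℝ) (Q : Ω → Prop) : Prop :=
  ∃ G : Set Ω, MeasurableSet G ∧ ENNReal.ofReal p ≤ P G ∧ ∀ ω ∈ G, Q ω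

end KernelEDMD

end

/-! Write `C = S^*S` with leading orthonormal eigenpairs `(λ_j, f_j)`. The vectors `S f_j / √λ_j`,
`j ≤ r`, form an orthonormal basis of the range of `P_r`, so `P_r K = S [C]_r^† S^*K`. Here `S^*K`
is the mean of the empirical cross-covariance, just as `C` is the mean of the empirical covariance.
The error therefore splits as `S [C]_r^† (S^*K - Ĉ_XY) + S ([C]_r^† - [Ĉ]_r^†) Ĉ_XY`.

If both empirical operators are within `η ≤ δ_r` of their means, the first term is at most `η /
√λ_r` (`norm_comp_pinvOf_le`). In the second, `norm_pinvOf_sub_le` bounds the middle factor by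
`(r+1) η / (δ_r λ_r)`. It rests on Weyl's inequality `abs_eigVal_sub_le` and on a sine bound for
each simple eigenvector, `norm_eigenprojection_sub_le`.

The delicate factor is `‖Ĉ_XY‖`: the constant `c_r` only admits the integral of the kernel diagonal,
not its supremum `M`. With `N = ‖φ‖_{L¹(𝒳)}`, Cauchy–Schwarz gives `‖Ĉ_XY‖ ≤ √(2NM)`. The excess is
absorbed by a Bernstein inequality in Hilbert space (`measureReal_norm_sum_ge_le`) with variance at
most `MN`. The given sample size then yields the sharper accuracy `η = ε √(N/(2M))`, and `η √(2NM) =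
εN`.

When `K` maps into the range of `S`, the closed graph theorem gives a bounded factor `KXY` with `K =
S KXY`, and `‖S - P_r S‖ ≤ √λ_{r+1}` controls the bias. -/

namespace KernelEDMD

/-! ### Leading eigenvalues of compact positive operators: min-max and Weyl. -/

section SpectralTheory

variable {E : Type*} [NormedAddCommGroup E] [InnerProductSpace ℝ E]

lemma mem_eigenspaceGE {T : E →L[ℝ] E} {a s : ℝ} {v : E} (hs : a ≤ s) (hv : T v = s • v) :
    v ∈ eigenspaceGE T a :=
  Submodule.mem_iSup_of_mem s (Submodule.mem_iSup_of_mem hs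
    (Module.End.mem_eigenspace_iff.2 hv))

/-- Eigenspaces of a symmetric operator are mutually orthogonal, so the quadratic form is a sum of
`s ‖v_s‖²` with every `s ≥ a`. This is the lower half of the min-max principle. -/
lemma le_inner_of_mem_eigenspaceGE {T : E →L[ℝ] E} (hT : T.IsPositive) {a : ℝ} {v : E}
    (hv : v ∈ eigenspaceGE T a) : a * ‖v‖ ^ 2 ≤ inner ℝ (T v) v := by
  rw [eigenspaceGE, iSup_subtype', Submodule.mem_iSup_iff_exists_finsupp] at hv
  obtain ⟨f, hf, rfl⟩ := hv
  have hfam := (LinearMap.IsSymmetric.orthogonalFamily_eigenspaces hT.1).comp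
    (f := fun s : Set.Ici a => (s : ℝ)) Subtype.val_injective
  let g : (s : Set.Ici a) → Module.End.eigenspace (T : E →ₗ[ℝ] E) (s : ℝ) := fun s => ⟨f s, hf s⟩
  have h1 : f.sum (fun _ xi => xi) = ∑ s ∈ f.support,
      (Module.End.eigenspace (T : E →ₗ[ℝ] E) (s : ℝ)).subtypeₗᵢ (g s) := rfl
  have h2 : T (f.sum fun _ xi => xi) = ∑ s ∈ f.support,
      (Module.End.eigenspace (T : E →ₗ[ℝ] E) (s : ℝ)).subtypeₗᵢ ((s : ℝ) • g s) := by
    rw [h1, map_sum]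
    refine Finset.sum_congr rfl fun s _ => ?_
    exact Module.End.mem_eigenspace_iff.1 (hf s)
  rw [h2, h1, hfam.norm_sum g, hfam.inner_sum (fun s => (s : ℝ) • g s) g, Finset.mul_sum]
  refine Finset.sum_le_sum fun s _ => ?_
  rw [real_inner_smul_left, real_inner_self_eq_norm_sq]
  exact mul_le_mul_of_nonneg_right s.2 (sq_nonneg _)

lemma inner_map_self_le (T : E →L[ℝ] E) (v : E) : inner ℝ (T v) v ≤ ‖T‖ * ‖v‖ ^ 2 :=
  calc inner ℝ (T v) v ≤ ‖T v‖ * ‖v‖ := real_inner_le_norm _ _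
    _ ≤ ‖T‖ * ‖v‖ * ‖v‖ := by gcongr; exact T.le_opNorm v
    _ = ‖T‖ * ‖v‖ ^ 2 := by ring

/-- A subspace of dimension larger than `n` meets the orthogonal complement of `n` vectors. -/
lemma exists_mem_orthogonal {n j : ℕ} (hnj : n < j) (V : Submodule ℝ E)
    (hV : (j : Cardinal) ≤ Module.rank ℝ V) (f : Fin n → E) :
    ∃ v ∈ V, v ≠ 0 ∧ ∀ i, inner ℝ (f i) v = 0 := by
  let L : V →ₗ[ℝ] (Fin n → ℝ) :=
    LinearMap.pi fun i => (innerSL ℝ (f i) : E →ₗ[ℝ] ℝ) ∘ₗ V.subtype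
  have hL : ¬ Function.Injective L := fun hinj => by
    have h1 := LinearMap.lift_rank_le_of_injective L hinj
    have h2 : j ≤ n := by simpa using (Cardinal.lift_le.2 hV).trans h1
    omega
  rw [← LinearMap.ker_eq_bot] at hL
  replace hL := (Submodule.ne_bot_iff _).1 hL
  obtain ⟨v, hv, hv0⟩ := hL
  exact ⟨v, v.2, fun h => hv0 (Subtype.ext h), fun i => congrFun hv i⟩

lemma exists_ne_zero_of_le_rank {j : ℕ} (hj : 1 ≤ j) (V : Submodule ℝ E)
    (hV : (j : Cardinal) ≤ Module.rank ℝ V) : ∃ v ∈ V, v ≠ 0 := by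
  obtain ⟨v, hv, hv0, -⟩ := exists_mem_orthogonal (n := 0) (by omega) V hV Fin.elim0
  exact ⟨v, hv, hv0⟩

/-- For `j = 0` the set is unbounded and its real supremum is the default `0`; hence the condition
`1 ≤ j` here and in the lemmas on `eigVal` that use this bound. -/
lemma bddAbove_eigVal_set {T : E →L[ℝ] E} (hT : T.IsPositive) {j : ℕ} (hj : 1 ≤ j) :
    BddAbove {a : ℝ | 0 < a ∧ (j : Cardinal) ≤ Module.rank ℝ (eigenspaceGE T a)} := by
  refine ⟨‖T‖, fun a ⟨_, ha⟩ => ?_⟩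
  obtain ⟨v, hv, hv0⟩ := exists_ne_zero_of_le_rank hj _ ha
  have h := (le_inner_of_mem_eigenspaceGE hT hv).trans (inner_map_self_le T v)
  exact le_of_mul_le_mul_right h (by positivity)

lemma eigVal_nonneg (T : E →L[ℝ] E) (j : ℕ) : 0 ≤ eigVal T j :=
  Real.sSup_nonneg fun _ h => h.1.le

lemma eigVal_succ_le {T : E →L[ℝ] E} (hT : T.IsPositive) {j : ℕ} (hj : 1 ≤ j) :
    eigVal T (j + 1) ≤ eigVal T j := by
  refine Real.sSup_le (fun a ⟨ha0, ha⟩ => le_csSup (bddAbove_eigVal_set hT hj) ⟨ha0, ?_⟩)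
    (eigVal_nonneg T j)
  exact le_trans (by exact_mod_cast Nat.le_succ j) ha

lemma eigVal_anti {T : E →L[ℝ] E} (hT : T.IsPositive) {i j : ℕ} (hi : 1 ≤ i) (hij : i ≤ j) :
    eigVal T j ≤ eigVal T i := by
  induction j, hij using Nat.le_induction with
  | base => exact le_rfl
  | succ j hj ih => exact (eigVal_succ_le hT (hi.trans hj)).trans ih

lemma eigVal_le_norm {T : E →L[ℝ] E} (hT : T.IsPositive) {j : ℕ} (hj : 1 ≤ j) :
    eigVal T j ≤ ‖T‖ := by
  refine Real.sSup_le (fun a ⟨_, ha⟩ => ?_) (norm_nonneg T)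
  obtain ⟨v, hv, hv0⟩ := exists_ne_zero_of_le_rank hj _ ha
  have h := (le_inner_of_mem_eigenspaceGE hT hv).trans (inner_map_self_le T v)
  exact le_of_mul_le_mul_right h (by positivity)

/-- Orthonormal eigenvectors with eigenvalues at least `a` bound the leading eigenvalues. -/
lemma le_eigVal {T : E →L[ℝ] E} (hT : T.IsPositive) {j : ℕ} (hj : 1 ≤ j) {a : ℝ} (ha : 0 < a)
    {g : Fin j → E} (hg : Orthonormal ℝ g) {s : Fin j → ℝ} (hs : ∀ i, a ≤ s i)
    (hgs : ∀ i, T (g i) = s i • g i) : a ≤ eigVal T j := by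
  refine le_csSup (bddAbove_eigVal_set hT hj) ⟨ha, ?_⟩
  let g' : Fin j → eigenspaceGE T a := fun i => ⟨g i, mem_eigenspaceGE (hs i) (hgs i)⟩
  have hli : LinearIndependent ℝ g' :=
    LinearIndependent.of_comp (eigenspaceGE T a).subtype hg.linearIndependent
  simpa using hli.cardinal_lift_le_rank

lemma orthonormal_snoc {n : ℕ} {f : Fin n → E} (hf : Orthonormal ℝ f) {g : E} (hg : ‖g‖ = 1)
    (hfg : ∀ i, inner ℝ (f i) g = 0) : Orthonormal ℝ (Fin.snoc f g : Fin (n + 1) → E) := by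
  constructor
  · intro i
    refine Fin.lastCases ?_ (fun i => ?_) i
    · simpa using hg
    · simpa using hf.1 i
  · intro i
    refine Fin.lastCases ?_ (fun i => ?_) i
    · intro j
      refine Fin.lastCases (fun h => (h rfl).elim) (fun j _ => ?_) j
      simpa [real_inner_comm] using hfg j
    · intro j
      refine Fin.lastCases (fun _ => ?_) (fun j h => ?_) j
      · simpa using hfg i
      · simpa using hf.2 (fun h' => h (by rw [h']))

lemma mem_orthogonal_span_iff {n : ℕ} {f : Fin n → E} {w : E} :
    w ∈ (Submodule.span ℝ (Set.range f))ᗮ ↔ ∀ i, inner ℝ (f i) w = 0 := by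
  rw [Submodule.mem_orthogonal]
  refine ⟨fun h i => h _ (Submodule.subset_span ⟨i, rfl⟩), fun h u hu => ?_⟩
  induction hu using Submodule.span_induction with
  | mem x hx => obtain ⟨i, rfl⟩ := hx; exact h i
  | zero => simp
  | add x y _ _ hx hy => rw [inner_add_left, hx, hy, add_zero]
  | smul a x _ hx => rw [real_inner_smul_left, hx, mul_zero]

lemma IsLeadingEigensystem.restrict {T : E →L[ℝ] E} {n : ℕ} {f : Fin n → E}
    (hf : IsLeadingEigensystem T n f) {j : ℕ} (hj : j ≤ n) :
    IsLeadingEigensystem T j (f ∘ Fin.castLE hj) where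
  orthonormal := hf.orthonormal.comp _ (Fin.castLE_injective hj)
  eigen i := hf.eigen (Fin.castLE hj i)

variable [CompleteSpace E]

/-- A compact positive operator attains its norm as an eigenvalue. -/
lemma exists_eigenvector_norm {T : E →L[ℝ] E} (hT : T.IsPositive) (hc : IsCompactOperator T)
    (h0 : T ≠ 0) : ∃ g : E, ‖g‖ = 1 ∧ T g = ‖T‖ • g := by
  -- For a self-adjoint operator the spectral radius is the norm. Compactness turns the extremal
  -- nonzero spectral value into an eigenvalue, and positivity fixes its sign.
  have hrad := T.spectralRadius_eq_nnnorm hT.1.isSelfAdjoint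
  have hne : (spectrum ℝ T).Nonempty := by
    by_contra h
    rw [Set.not_nonempty_iff_eq_empty] at h
    rw [spectralRadius, h] at hrad
    simp only [mem_empty_iff_false, iSup_false, iSup_bot] at hrad
    exact h0 (nnnorm_eq_zero.1 (ENNReal.coe_eq_zero.1 hrad.symm))
  obtain ⟨s, hs, hs'⟩ := spectrum.exists_nnnorm_eq_spectralRadius_of_nonempty hne
  rw [hrad, ENNReal.coe_inj] at hs'
  have habs : |s| = ‖T‖ := congrArg NNReal.toReal hs'
  have hs0 : s ≠ 0 := by
    rintro rfl
    rw [abs_zero] at habs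
    exact h0 (norm_eq_zero.1 habs.symm)
  obtain ⟨v, hv⟩ := ((hc.hasEigenvalue_iff_mem_spectrum hs0).2 hs).exists_hasEigenvector
  have hTv : T v = s • v := hv.apply_eq_smul
  have hv0 : v ≠ 0 := hv.2
  have hpos : 0 ≤ s := by
    have h1 : 0 ≤ inner ℝ (T v) v := hT.2 v
    rw [hTv, real_inner_smul_left, real_inner_self_eq_norm_sq] at h1
    exact nonneg_of_mul_nonneg_left h1 (by positivity)
  rw [abs_of_nonneg hpos] at habs
  refine ⟨‖v‖⁻¹ • v, ?_, ?_⟩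
  · rw [norm_smul, norm_inv, norm_norm, inv_mul_cancel₀ (norm_ne_zero_iff.2 hv0)]
  · rw [map_smul, hTv, ← habs, smul_comm]

/-- The orthogonal projection onto the orthogonal complement of finitely many vectors. -/
noncomputable def projOff {n : ℕ} (f : Fin n → E) : E →L[ℝ] E :=
  (Submodule.span ℝ (Set.range f))ᗮ.starProjection

lemma inner_projOff {n : ℕ} (f : Fin n → E) (w : E) (i : Fin n) :
    inner ℝ (f i) (projOff f w) = 0 :=
  mem_orthogonal_span_iff.1 (Submodule.starProjection_apply_mem _ w) i

lemma projOff_eq_self {n : ℕ} {f : Fin n → E} {w : E} (h : ∀ i, inner ℝ (f i) w = 0) :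
    projOff f w = w :=
  Submodule.starProjection_eq_self_iff.2 (mem_orthogonal_span_iff.2 h)

lemma norm_projOff_le {n : ℕ} (f : Fin n → E) (w : E) : ‖projOff f w‖ ≤ ‖w‖ :=
  Submodule.norm_starProjection_apply_le _ w

lemma projOff_eq {n : ℕ} {f : Fin n → E} (hf : Orthonormal ℝ f) (w : E) :
    projOff f w = w - ∑ i, inner ℝ (f i) w • f i := by
  refine Submodule.eq_starProjection_of_mem_of_inner_eq_zero
    (mem_orthogonal_span_iff.2 fun i => ?_) (fun u hu => ?_)
  · rw [inner_sub_right, hf.inner_right_fintype, sub_self]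
  · rw [sub_sub_cancel, sum_inner]
    refine Finset.sum_eq_zero fun i _ => ?_
    rw [real_inner_smul_left, mem_orthogonal_span_iff.1 hu i, mul_zero]

namespace IsLeadingEigensystem

variable {T : E →L[ℝ] E} {n : ℕ} {f : Fin n → E}

/-- The norm of the compression of `T` to the complement of a leading eigensystem is an
eigenvalue of `T`, if it does not vanish. -/
lemma exists_next (hf : IsLeadingEigensystem T n f) (hT : T.IsPositive) (hc : IsCompactOperator T)
    (h0 : projOff f ∘L T ∘L projOff f ≠ 0) :
    ∃ g : E, ‖g‖ = 1 ∧ (∀ i, inner ℝ (f i) g = 0) ∧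
      T g = ‖projOff f ∘L T ∘L projOff f‖ • g := by
  set T' := projOff f ∘L T ∘L projOff f with hT'
  have hpos : T'.IsPositive := hT.conj_starProjection _
  have hcomp : IsCompactOperator T' := (hc.comp_clm (projOff f)).clm_comp (projOff f)
  obtain ⟨g, hg1, hg⟩ := exists_eigenvector_norm hpos hcomp h0
  have hs : ‖T'‖ ≠ 0 := norm_ne_zero_iff.2 h0
  have hperp : ∀ i, inner ℝ (f i) g = 0 := fun i => by
    have h1 : inner ℝ (f i) (T' g) = 0 := inner_projOff f _ i
    rw [hg, real_inner_smul_right] at h1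
    exact (mul_eq_zero.1 h1).resolve_left hs
  refine ⟨g, hg1, hperp, ?_⟩
  -- `T` preserves the complement of its eigenvectors, so an eigenvector of the compression lying
  -- there is one of `T` itself.
  have hTg : ∀ i, inner ℝ (f i) (T g) = 0 := fun i => by
    have h2 : inner ℝ (T (f i)) g = inner ℝ (f i) (T g) := hT.1 (f i) g
    rw [← h2, hf.eigen, real_inner_smul_left, hperp, mul_zero]
  have h3 : T' g = T g := by
    simp only [hT', ContinuousLinearMap.comp_apply, projOff_eq_self hperp, projOff_eq_self hTg]
  rw [← h3, hg]

lemma norm_compression_le (hf : IsLeadingEigensystem T n f) (hT : T.IsPositive)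
    (hc : IsCompactOperator T) :
    ‖projOff f ∘L T ∘L projOff f‖ ≤ eigVal T (n + 1) := by
  by_cases h0 : projOff f ∘L T ∘L projOff f = 0
  · rw [h0, norm_zero]; exact eigVal_nonneg T _
  obtain ⟨g, hg1, hperp, hg⟩ := hf.exists_next hT hc h0
  set s := ‖projOff f ∘L T ∘L projOff f‖
  have hs : 0 < s := norm_pos_iff.2 h0
  -- Bootstrapping: once `s` is below the first `i + 1` eigenvalues, the vectors `f 0, …, f i, g`
  -- are `i + 2` orthonormal eigenvectors with eigenvalues at least `s`, which pushes `s` below the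
  -- next one.
  have key : ∀ i, i ≤ n → ∀ l, l ≤ i → s ≤ eigVal T (l + 1) := by
    intro i
    induction i with
    | zero =>
      intro _ l hl
      obtain rfl : l = 0 := by omega
      refine le_eigVal hT le_rfl hs (g := fun _ => g) (s := fun _ => s) ?_ (fun _ => le_rfl)
        (fun _ => hg)
      exact ⟨fun _ => hg1, fun a b hab => (hab (Subsingleton.elim a b)).elim⟩
    | succ i ih =>
      intro hi l hl
      rcases Nat.lt_or_ge l (i + 1) with h | h
      · exact ih (by omega) l (by omega)
      obtain rfl : l = i + 1 := by omega
      have hr := hf.restrict hi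
      refine le_eigVal hT (by omega) hs
        (orthonormal_snoc hr.orthonormal hg1 fun m => hperp _)
        (s := Fin.snoc (fun m : Fin (i + 1) => eigVal T (m + 1)) s) ?_ ?_
      · intro m
        refine Fin.lastCases ?_ (fun m => ?_) m
        · simp
        · simpa using ih (by omega) m (by omega)
      · intro m
        refine Fin.lastCases ?_ (fun m => ?_) m
        · simpa using hg
        · simpa using hf.eigen (Fin.castLE hi m)
  exact key n le_rfl n le_rfl

/-- On the orthogonal complement of a leading eigensystem of length `n`, the quadratic form of `T`
is bounded by the `(n+1)`-st eigenvalue. -/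
lemma inner_le (hf : IsLeadingEigensystem T n f) (hT : T.IsPositive) (hc : IsCompactOperator T)
    {w : E} (hw : ∀ i, inner ℝ (f i) w = 0) :
    inner ℝ (T w) w ≤ eigVal T (n + 1) * ‖w‖ ^ 2 := by
  have h1 : inner ℝ ((projOff f ∘L T ∘L projOff f) w) w = inner ℝ (T w) w := by
    have : inner ℝ (projOff f (T w)) w = inner ℝ (T w) (projOff f w) :=
      Submodule.inner_starProjection_left_eq_right _ _ _
    simp only [ContinuousLinearMap.comp_apply, projOff_eq_self hw]
    rw [this, projOff_eq_self hw]
  rw [← h1]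
  refine (inner_map_self_le _ w).trans ?_
  gcongr
  exact hf.norm_compression_le hT hc

/-- The norm of the compression is exactly the next eigenvalue: a space of dimension at least `n +
1` on which the form is at least `a` meets the complement of `f`, which gives the bound missing from
`norm_compression_le`. An eigenvector attaining this norm extends the system. -/
lemma exists_snoc (hf : IsLeadingEigensystem T n f) (hT : T.IsPositive) (hc : IsCompactOperator T)
    (hpos : 0 < eigVal T (n + 1)) :
    ∃ g : E, IsLeadingEigensystem T (n + 1) (Fin.snoc f g) := by
  set s := ‖projOff f ∘L T ∘L projOff f‖ with hs
  have hle : s ≤ eigVal T (n + 1) := hf.norm_compression_le hT hc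
  have hge : eigVal T (n + 1) ≤ s := by
    refine Real.sSup_le (fun a ⟨_, ha⟩ => ?_) (norm_nonneg _)
    obtain ⟨v, hv, hv0, hperp⟩ := exists_mem_orthogonal (Nat.lt_succ_self n) _ ha f
    have h1 := le_inner_of_mem_eigenspaceGE hT hv
    have h2 : inner ℝ ((projOff f ∘L T ∘L projOff f) v) v = inner ℝ (T v) v := by
      have : inner ℝ (projOff f (T v)) v = inner ℝ (T v) (projOff f v) :=
        Submodule.inner_starProjection_left_eq_right _ _ _
      simp only [ContinuousLinearMap.comp_apply, projOff_eq_self hperp]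
      rw [this, projOff_eq_self hperp]
    rw [← h2] at h1
    exact le_of_mul_le_mul_right (h1.trans (inner_map_self_le _ v)) (by positivity)
  have heq := le_antisymm hle hge
  obtain ⟨g, hg1, hperp, hg⟩ := hf.exists_next hT hc
    (norm_ne_zero_iff.1 (by rw [← hs, heq]; exact hpos.ne'))
  rw [← hs, heq] at hg
  refine ⟨g, orthonormal_snoc hf.orthonormal hg1 hperp, fun j => ?_⟩
  refine Fin.lastCases ?_ (fun j => ?_) j
  · simpa using hg
  · simpa using hf.eigen j

end IsLeadingEigensystem

lemma exists_isLeadingEigensystem {T : E →L[ℝ] E} (hT : T.IsPositive) (hc : IsCompactOperator T)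
    (n : ℕ) (hn : n = 0 ∨ 0 < eigVal T n) : ∃ f : Fin n → E, IsLeadingEigensystem T n f := by
  induction n with
  | zero => exact ⟨Fin.elim0, ⟨fun i => i.elim0, fun i => i.elim0⟩, fun i => i.elim0⟩
  | succ n ih =>
    have hn' : 0 < eigVal T (n + 1) := hn.resolve_left (Nat.succ_ne_zero n)
    obtain ⟨f, hf⟩ := ih (by
      rcases Nat.eq_zero_or_pos n with h | h
      · exact Or.inl h
      · exact Or.inr (hn'.trans_le (eigVal_succ_le hT h)))
    obtain ⟨g, hg⟩ := hf.exists_snoc hT hc hn'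
    exact ⟨_, hg⟩

/-- The `j`-th eigenvalue bounds the quadratic form on the complement of fewer than `j` vectors. -/
lemma exists_inner_le_eigVal {T : E →L[ℝ] E} (hT : T.IsPositive) (hc : IsCompactOperator T)
    {j : ℕ} (hj : 1 ≤ j) : ∃ n < j, ∃ f : Fin n → E, ∀ w : E, (∀ i, inner ℝ (f i) w = 0) →
      inner ℝ (T w) w ≤ eigVal T j * ‖w‖ ^ 2 := by
  induction j, hj using Nat.le_induction with
  | base =>
    obtain ⟨f, hf⟩ := exists_isLeadingEigensystem hT hc 0 (Or.inl rfl)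
    exact ⟨0, Nat.one_pos, f, fun w hw => hf.inner_le hT hc hw⟩
  | succ j hj ih =>
    rcases (eigVal_nonneg T j).eq_or_lt with h | h
    -- If the `j`-th eigenvalue vanishes, so does the next, and the vectors found for `j` still
    -- serve. There may be no further leading system, which is why only `n < j` is asked.
    · obtain ⟨n, hn, f, hf⟩ := ih
      refine ⟨n, by omega, f, fun w hw => ?_⟩
      rw [le_antisymm ((eigVal_succ_le hT hj).trans h.symm.le) (eigVal_nonneg T _), h]
      exact hf w hw
    · obtain ⟨f, hf⟩ := exists_isLeadingEigensystem hT hc j (Or.inr h)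
      exact ⟨j, Nat.lt_succ_self j, f, fun w hw => hf.inner_le hT hc hw⟩

/-- Weyl's perturbation inequality. -/
lemma eigVal_le_add_norm_sub {A B : E →L[ℝ] E} (hA : A.IsPositive) (hB : B.IsPositive)
    (hcB : IsCompactOperator B) {j : ℕ} (hj : 1 ≤ j) :
    eigVal A j ≤ eigVal B j + ‖A - B‖ := by
  refine Real.sSup_le (fun a ⟨_, ha⟩ => ?_) (add_nonneg (eigVal_nonneg B j) (norm_nonneg _))
  obtain ⟨n, hn, f, hf⟩ := exists_inner_le_eigVal hB hcB hj
  -- A dimension count yields a vector on which the form of `A` is at least `a` and that of `B` at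
  -- most `eigVal B j`.
  obtain ⟨v, hv, hv0, hperp⟩ := exists_mem_orthogonal hn _ ha f
  have h1 := le_inner_of_mem_eigenspaceGE hA hv
  have h2 : inner ℝ (A v) v = inner ℝ (B v) v + inner ℝ ((A - B) v) v := by
    rw [_root_.sub_apply, inner_sub_left]; ring
  have h3 := inner_map_self_le (A - B) v
  have h4 := hf v hperp
  refine le_of_mul_le_mul_right (a := ‖v‖ ^ 2) ?_ (by positivity)
  linarith

lemma abs_eigVal_sub_le {A B : E →L[ℝ] E} (hA : A.IsPositive) (hB : B.IsPositive)
    (hcA : IsCompactOperator A) (hcB : IsCompactOperator B) {j : ℕ} (hj : 1 ≤ j) :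
    |eigVal A j - eigVal B j| ≤ ‖A - B‖ := by
  have h1 := eigVal_le_add_norm_sub hA hB hcB hj
  have h2 := eigVal_le_add_norm_sub hB hA hcA hj
  rw [norm_sub_rev] at h2
  rw [abs_le]
  constructor <;> linarith

end SpectralTheory

/-! ### Perturbation of eigenprojections and truncated pseudo-inverses. -/

section Perturbation

variable {E : Type*} [NormedAddCommGroup E] [InnerProductSpace ℝ E]

lemma norm_sub_inner_smul_sq {f : E} (hf : ‖f‖ = 1) (y : E) :
    ‖y - inner ℝ f y • f‖ ^ 2 = ‖y‖ ^ 2 - inner ℝ f y ^ 2 := by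
  rw [norm_sub_sq_real, real_inner_smul_right, norm_smul, hf, real_inner_comm, mul_one,
    Real.norm_eq_abs, sq_abs]
  ring

/-- The distance of two rank-one orthogonal projections is at most the sine of the angle. -/
lemma norm_rankOne_sub_rankOne_le {f g : E} (hf : ‖f‖ = 1) (hg : ‖g‖ = 1) :
    ‖InnerProductSpace.rankOne ℝ f f - InnerProductSpace.rankOne ℝ g g‖ ≤
      ‖g - inner ℝ f g • f‖ := by
  refine ContinuousLinearMap.opNorm_le_bound _ (norm_nonneg _) fun x => ?_
  set c := inner ℝ f g with hc
  set h := g - c • f with hh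
  set p := inner ℝ f x with hp
  have hfh : inner ℝ f h = 0 := by
    rw [hh, inner_sub_right, real_inner_smul_right, real_inner_self_eq_norm_sq, hf]; simp [hc]
  have hgx : inner ℝ g x = c * p + inner ℝ h x := by
    rw [hh, inner_sub_left, real_inner_smul_left]; ring
  have hhx : inner ℝ h x = inner ℝ h (x - p • f) := by
    rw [inner_sub_right, real_inner_smul_right, real_inner_comm f h, hfh, mul_zero, sub_zero]
  have hcs : inner ℝ h x ^ 2 ≤ ‖h‖ ^ 2 * (‖x‖ ^ 2 - p ^ 2) := by
    rw [hhx, ← norm_sub_inner_smul_sq hf x, ← mul_pow, ← sq_abs (inner ℝ h _)]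
    gcongr
    exact abs_real_inner_le_norm _ _
  have hh2 : ‖h‖ ^ 2 = 1 - c ^ 2 := by rw [norm_sub_inner_smul_sq hf, hg, one_pow]
  rw [← abs_norm, ← abs_of_nonneg (mul_nonneg (norm_nonneg h) (norm_nonneg x)), ← sq_le_sq]
  rw [_root_.sub_apply, InnerProductSpace.rankOne_apply, InnerProductSpace.rankOne_apply,
    norm_sub_sq_real, norm_smul, norm_smul, hf, hg, real_inner_smul_left, real_inner_smul_right,
    mul_one, mul_one, Real.norm_eq_abs, Real.norm_eq_abs, sq_abs, sq_abs, hgx, ← hc, ← hp]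
  -- The squared left side equals `‖h‖² p² + ⟨h, x⟩²`, and `hcs` bounds the second summand by `‖h‖²
  -- (‖x‖² - p²)`.
  nlinarith

lemma norm_sum_smul_rankOne_le {ι : Type*} [Fintype ι] {f : ι → E} (hf : Orthonormal ℝ f)
    {c : ι → ℝ} {M : ℝ} (hM : 0 ≤ M) (hc : ∀ i, |c i| ≤ M) :
    ‖∑ i, c i • InnerProductSpace.rankOne ℝ (f i) (f i)‖ ≤ M := by
  refine ContinuousLinearMap.opNorm_le_bound _ hM fun x => ?_
  have h1 : (∑ i, c i • InnerProductSpace.rankOne ℝ (f i) (f i)) x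
      = ∑ i, (c i * inner ℝ (f i) x) • f i := by
    simp [smul_smul]
  rw [h1, ← abs_norm, ← abs_of_nonneg (mul_nonneg hM (norm_nonneg x)), ← sq_le_sq,
    ← real_inner_self_eq_norm_sq, hf.inner_sum]
  have h2 : ∑ i, ‖inner ℝ (f i) x‖ ^ 2 ≤ ‖x‖ ^ 2 := hf.sum_inner_products_le x
  calc ∑ i, (starRingEnd ℝ) (c i * inner ℝ (f i) x) * (c i * inner ℝ (f i) x)
      ≤ ∑ i, M ^ 2 * ‖inner ℝ (f i) x‖ ^ 2 := by
        refine Finset.sum_le_sum fun i _ => ?_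
        rw [Real.norm_eq_abs, sq_abs, conj_trivial, ← sq, mul_pow]
        exact mul_le_mul_of_nonneg_right (sq_le_sq.2 (by rw [abs_of_nonneg hM]; exact hc i))
          (sq_nonneg _)
    _ ≤ (M * ‖x‖) ^ 2 := by rw [← Finset.mul_sum, mul_pow]; gcongr

variable [CompleteSpace E]

/-- The truncated pseudo-inverse built from an eigensystem. -/
noncomputable def pinvOf (T : E →L[ℝ] E) {r : ℕ} (f : Fin r → E) : E →L[ℝ] E :=
  ∑ j : Fin r, (eigVal T (j + 1))⁻¹ • InnerProductSpace.rankOne ℝ (f j) (f j)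

namespace IsLeadingEigensystem

variable {T T' : E →L[ℝ] E} {r : ℕ} {f f' : Fin r → E}

/-- Off the eigenvector `f j`, the operator `T - t` is bounded below by the distance of `t` to the
other eigenvalues. -/
lemma le_norm_sub_smul (hf : IsLeadingEigensystem T r f) (hT : T.IsPositive)
    (hc : IsCompactOperator T) (j : Fin r) {t d : ℝ}
    (hup : ∀ i : Fin r, i < j → t + d ≤ eigVal T (i + 1)) (hlow : eigVal T (j + 2) + d ≤ t)
    {g : E} (hg : inner ℝ (f j) g = 0) : d * ‖g‖ ≤ ‖T g - t • g‖ := by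
  -- Split `g = u + w`, with `u` in the span of the eigenvectors before `f j` and `w` orthogonal to
  -- these and to `f j`. The form of `T` is at least `t + d` on `u` and at most `t - d` on `w`.
  set f₀ := f ∘ Fin.castLE j.2.le with hf₀
  have hr₀ := hf.restrict j.2.le
  set w := projOff f₀ g with hw
  set u := g - w with hu
  have hu' : u = ∑ i, inner ℝ (f₀ i) g • f₀ i := by rw [hu, hw, projOff_eq hr₀.orthonormal]; abel
  have huw : inner ℝ u w = 0 := by
    rw [hu', sum_inner]
    exact Finset.sum_eq_zero fun i _ => by
      rw [real_inner_smul_left, inner_projOff, mul_zero]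
  have hwf : ∀ i : Fin (j + 1), inner ℝ ((f ∘ Fin.castLE j.2) i) w = 0 := by
    refine Fin.lastCases ?_ fun i => inner_projOff f₀ g i
    have hne : ∀ i, inner ℝ (f j) (f₀ i) = 0 := fun i => by
      refine hf.orthonormal.2 fun h => ?_
      have := congrArg Fin.val h
      simp only [Fin.val_castLE] at this
      omega
    have h1 : inner ℝ (f j) w = 0 := by
      rw [hw, projOff_eq hr₀.orthonormal, inner_sub_right, hg, inner_sum, zero_sub, neg_eq_zero]
      exact Finset.sum_eq_zero fun i _ => by rw [real_inner_smul_right, hne, mul_zero]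
    exact h1
  have h1 : (t + d) * ‖u‖ ^ 2 ≤ inner ℝ (T u) u := by
    refine le_inner_of_mem_eigenspaceGE hT ?_
    rw [hu']
    refine Submodule.sum_mem _ fun i _ => Submodule.smul_mem _ _ ?_
    exact mem_eigenspaceGE (hup (Fin.castLE j.2.le i) i.2) (hr₀.eigen i)
  have h2 : inner ℝ (T w) w ≤ eigVal T (j + 2) * ‖w‖ ^ 2 :=
    (hf.restrict (j := j + 1) j.2).inner_le hT hc hwf
  have hguw : g = u + w := by rw [hu]; abel
  have hn1 : ‖g‖ ^ 2 = ‖u‖ ^ 2 + ‖w‖ ^ 2 := by rw [hguw, norm_add_sq_real, huw]; ring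
  have hn2 : ‖u - w‖ = ‖g‖ := by
    have : ‖u - w‖ ^ 2 = ‖g‖ ^ 2 := by rw [hn1, norm_sub_sq_real, huw]; ring
    exact (sq_eq_sq₀ (norm_nonneg _) (norm_nonneg _)).1 this
  have hsymm : inner ℝ (T u) w = inner ℝ (T w) u := by
    rw [real_inner_comm u (T w)]; exact hT.1 u w
  -- Testing against the reflected vector `u - w` makes both parts contribute with a positive sign,
  -- and `‖u - w‖ = ‖g‖` loses nothing.
  have h3 : inner ℝ (T g - t • g) (u - w)
      = inner ℝ (T u) u - inner ℝ (T w) w - t * (‖u‖ ^ 2 - ‖w‖ ^ 2) := by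
    rw [hguw, map_add]
    simp only [inner_sub_left, inner_sub_right, inner_add_left, real_inner_smul_left,
      real_inner_self_eq_norm_sq, hsymm, huw, real_inner_comm u w]
    ring
  have h4 : d * ‖g‖ ^ 2 ≤ ‖T g - t • g‖ * ‖g‖ := by
    calc d * ‖g‖ ^ 2 ≤ inner ℝ (T g - t • g) (u - w) := by
          rw [h3, hn1]; nlinarith [sq_nonneg ‖u‖, sq_nonneg ‖w‖]
      _ ≤ ‖T g - t • g‖ * ‖u - w‖ := real_inner_le_norm _ _
      _ = _ := by rw [hn2]
  rcases eq_or_ne g 0 with rfl | h0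
  · simp
  · exact le_of_mul_le_mul_right (by linarith [h4, sq ‖g‖, mul_assoc d ‖g‖ ‖g‖])
      (norm_pos_iff.2 h0)

/-- Perturbation of the eigenprojection of a simple eigenvalue. -/
lemma norm_eigenprojection_sub_le (hf : IsLeadingEigensystem T r f)
    (hf' : IsLeadingEigensystem T' r f') (hT : T.IsPositive) (hT' : T'.IsPositive)
    (hc : IsCompactOperator T) (hc' : IsCompactOperator T') {η d : ℝ} (hd : 0 < d) (hηd : η ≤ d)
    (hη : ‖T - T'‖ ≤ η) (hgap : ∀ j : Fin r, 2 * d ≤ eigVal T (j + 1) - eigVal T (j + 2))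
    (j : Fin r) :
    ‖InnerProductSpace.rankOne ℝ (f j) (f j) - InnerProductSpace.rankOne ℝ (f' j) (f' j)‖
      ≤ η / d := by
  refine (norm_rankOne_sub_rankOne_le (hf.orthonormal.1 j) (hf'.orthonormal.1 j)).trans ?_
  rw [le_div_iff₀ hd, mul_comm]
  -- The shift is the perturbed eigenvalue, so that `(T - t) (f' j) = (T - T') (f' j)` has norm at
  -- most `η`. By Weyl and `η ≤ d`, half of the gap `2d` still separates `t` from the other
  -- eigenvalues of `T`.
  set t := eigVal T' (j + 1) with ht
  have habs : |eigVal T (j + 1) - t| ≤ η :=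
    (abs_eigVal_sub_le hT hT' hc hc' (by omega)).trans hη
  rw [abs_le] at habs
  set y := T (f' j) - t • f' j with hy
  have hy' : ‖y‖ ≤ η := by
    have : y = (T - T') (f' j) := by rw [hy, _root_.sub_apply, hf'.eigen]
    rw [this]
    refine ((T - T').le_opNorm _).trans ?_
    rw [hf'.orthonormal.1, mul_one]; exact hη
  have hperp : inner ℝ (f j) (f' j - inner ℝ (f j) (f' j) • f j) = 0 := by
    rw [inner_sub_right, real_inner_smul_right, real_inner_self_eq_norm_sq, hf.orthonormal.1]
    simp
  have h1 := hf.le_norm_sub_smul hT hc j (t := t) (d := d) (fun i hi => ?_)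
    (by linarith [hgap j]) hperp
  · refine h1.trans (le_trans ?_ hy')
    have h2 : inner ℝ (f j) y = (eigVal T (j + 1) - t) * inner ℝ (f j) (f' j) := by
      have h3 : inner ℝ (T (f j)) (f' j) = inner ℝ (f j) (T (f' j)) := hT.1 (f j) (f' j)
      rw [hf.eigen, real_inner_smul_left] at h3
      rw [hy, inner_sub_right, ← h3, real_inner_smul_right]; ring
    -- `T - t` commutes with the projection off `f j`; projecting `y` can only shorten it.
    have h4 : T (f' j - inner ℝ (f j) (f' j) • f j) - t • (f' j - inner ℝ (f j) (f' j) • f j)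
        = y - inner ℝ (f j) y • f j := by
      rw [h2, map_sub, map_smul, hf.eigen, hy]; module
    rw [h4]
    have h5 := norm_sub_inner_smul_sq (hf.orthonormal.1 j) y
    exact (sq_le_sq₀ (norm_nonneg _) (norm_nonneg _)).1 (by nlinarith [sq_nonneg (inner ℝ (f j) y)])
  · have h6 : eigVal T (j + 1) ≤ eigVal T (i + 2) :=
      eigVal_anti hT (by omega) (by have := Fin.lt_def.1 hi; omega)
    linarith [hgap i]

/-- Perturbation of the truncated pseudo-inverse. -/
lemma norm_pinvOf_sub_le (hf : IsLeadingEigensystem T r f)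
    (hf' : IsLeadingEigensystem T' r f') (hT : T.IsPositive) (hT' : T'.IsPositive)
    (hc : IsCompactOperator T) (hc' : IsCompactOperator T') {η d : ℝ} (hd : 0 < d) (hηd : η ≤ d)
    (hη : ‖T - T'‖ ≤ η) (hgap : ∀ j : Fin r, 2 * d ≤ eigVal T (j + 1) - eigVal T (j + 2))
    (hr : 1 ≤ r) :
    ‖pinvOf T f - pinvOf T' f'‖ ≤ (r + 1) / (d * eigVal T r) * η := by
  have hη0 : 0 ≤ η := (norm_nonneg _).trans hη
  have hlr : 2 * d ≤ eigVal T r := by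
    have h := hgap ⟨r - 1, by omega⟩
    have h' := eigVal_nonneg T (r - 1 + 2)
    simp only [Nat.sub_add_cancel hr] at h
    linarith
  have hr0 : 0 < eigVal T r := by linarith
  have hle : ∀ j : Fin r, eigVal T r ≤ eigVal T (j + 1) := fun j =>
    eigVal_anti hT (by omega) (by omega)
  have hW : ∀ j : Fin r, |eigVal T (j + 1) - eigVal T' (j + 1)| ≤ η := fun j =>
    (abs_eigVal_sub_le hT hT' hc hc' (by omega)).trans hη
  -- The `r` projection differences are added by the triangle inequality. The differences of inverse
  -- eigenvalues sit on one orthonormal system and cost only their maximum. Together they give the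
  -- factor `r + 1`.
  have hsplit : pinvOf T f - pinvOf T' f' =
      (∑ j : Fin r, (eigVal T (j + 1))⁻¹ • (InnerProductSpace.rankOne ℝ (f j) (f j) -
        InnerProductSpace.rankOne ℝ (f' j) (f' j))) +
      ∑ j : Fin r, ((eigVal T (j + 1))⁻¹ - (eigVal T' (j + 1))⁻¹) •
        InnerProductSpace.rankOne ℝ (f' j) (f' j) := by
    rw [pinvOf, pinvOf, ← Finset.sum_sub_distrib, ← Finset.sum_add_distrib]
    exact Finset.sum_congr rfl fun j _ => by module
  have h1 : ‖∑ j : Fin r, (eigVal T (j + 1))⁻¹ • (InnerProductSpace.rankOne ℝ (f j) (f j) -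
        InnerProductSpace.rankOne ℝ (f' j) (f' j))‖ ≤ r * ((eigVal T r)⁻¹ * (η / d)) := by
    refine (norm_sum_le _ _).trans ?_
    calc _ ≤ ∑ _j : Fin r, (eigVal T r)⁻¹ * (η / d) := by
          refine Finset.sum_le_sum fun j _ => ?_
          rw [norm_smul, Real.norm_of_nonneg (inv_nonneg.2 (eigVal_nonneg _ _))]
          have := hf.norm_eigenprojection_sub_le hf' hT hT' hc hc' hd hηd hη hgap j
          have := hle j
          gcongr
      _ = _ := by simp
  have h2 : ‖∑ j : Fin r, ((eigVal T (j + 1))⁻¹ - (eigVal T' (j + 1))⁻¹) •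
        InnerProductSpace.rankOne ℝ (f' j) (f' j)‖ ≤ (eigVal T r)⁻¹ * (η / d) := by
    refine norm_sum_smul_rankOne_le hf'.orthonormal (by positivity) fun j => ?_
    have hj := hle j
    have hWj := hW j
    have hp : 0 < eigVal T (j + 1) := hr0.trans_le hj
    have hp' : d ≤ eigVal T' (j + 1) := by
      rw [abs_le] at hWj
      linarith
    have hp0 : 0 < eigVal T' (j + 1) := hd.trans_le hp'
    rw [inv_sub_inv hp.ne' hp0.ne', abs_div, abs_sub_comm, abs_of_pos (mul_pos hp hp0)]
    calc _ ≤ η / (eigVal T r * d) := by gcongr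
      _ = _ := by field_simp
  rw [hsplit]
  refine ((norm_add_le _ _).trans (add_le_add h1 h2)).trans_eq ?_
  field_simp

end IsLeadingEigensystem

end Perturbation

/-! ### The Mercer projection and the deterministic error bound. -/

section Mercer

variable {E F : Type*} [NormedAddCommGroup E] [InnerProductSpace ℝ E] [CompleteSpace E]
  [NormedAddCommGroup F] [InnerProductSpace ℝ F] [CompleteSpace F]

lemma inner_covOp (S : E →L[ℝ] F) (x y : E) : inner ℝ (covOp S x) y = inner ℝ (S x) (S y) := by
  rw [covOp, ContinuousLinearMap.comp_apply, ContinuousLinearMap.adjoint_inner_left]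

lemma isPositive_covOp (S : E →L[ℝ] F) : (covOp S).IsPositive :=
  ContinuousLinearMap.isPositive_adjoint_comp_self S

namespace IsLeadingEigensystem

variable {S : E →L[ℝ] F} {r : ℕ} {f : Fin r → E}

lemma inner_map_map (hf : IsLeadingEigensystem (covOp S) r f) (i : Fin r) (x : E) :
    inner ℝ (S (f i)) (S x) = eigVal (covOp S) (i + 1) * inner ℝ (f i) x := by
  rw [← inner_covOp, hf.eigen, real_inner_smul_left]

/-- The component `w` off the leading system satisfies `⟨C w, w⟩ = s ‖w‖²`, while this form is at
most `λ_{r+1} ‖w‖²` there. Thus eigenvectors above `λ_{r+1}` lie in the span of `f`. -/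
lemma projOff_eq_zero (hf : IsLeadingEigensystem (covOp S) r f)
    (hc : IsCompactOperator (covOp S)) {s : ℝ} (hs : eigVal (covOp S) (r + 1) < s) {g : E}
    (hg : covOp S g = s • g) : projOff f g = 0 := by
  set w := projOff f g with hw
  have h1 := hf.inner_le (isPositive_covOp S) hc (w := w) (inner_projOff f g)
  have h2 : g = w + ∑ i, inner ℝ (f i) g • f i := by
    rw [hw, projOff_eq hf.orthonormal]; abel
  have h3 : inner ℝ w g = ‖w‖ ^ 2 := by
    conv_lhs => rw [h2]
    rw [inner_add_right, inner_sum, real_inner_self_eq_norm_sq, Finset.sum_eq_zero, add_zero]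
    intro i _
    rw [real_inner_smul_right, real_inner_comm (f i) w, inner_projOff, mul_zero]
  have h4 : inner ℝ (covOp S w) w = s * ‖w‖ ^ 2 := by
    have h5 : inner ℝ (covOp S w) g = inner ℝ w (covOp S g) := (isPositive_covOp S).1 w g
    rw [hg, real_inner_smul_right, h3] at h5
    rw [← h5]
    conv_rhs => rw [h2]
    rw [inner_add_right, inner_sum, Finset.sum_eq_zero, add_zero]
    intro i _
    rw [real_inner_smul_right, inner_covOp, real_inner_comm (S (f i)), hf.inner_map_map, inner_projOff,
      mul_zero, mul_zero]
  by_contra h0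
  have : 0 < ‖w‖ := norm_pos_iff.2 h0
  nlinarith [sq_pos_of_pos this]

/-- The Mercer projection in terms of a leading eigensystem of the covariance operator. -/
lemma mercerProj_apply (hf : IsLeadingEigensystem (covOp S) r f)
    (hc : IsCompactOperator (covOp S))
    (hlt : eigVal (covOp S) (r + 1) < eigVal (covOp S) r) (y : F) :
    mercerProj S r y = ∑ i : Fin r, ((eigVal (covOp S) (i + 1))⁻¹ * inner ℝ (S (f i)) y) •
      S (f i) := by
  have hT := isPositive_covOp S
  have hr0 : 0 < eigVal (covOp S) r := (eigVal_nonneg _ _).trans_lt hlt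
  have hle : ∀ j : Fin r, eigVal (covOp S) r ≤ eigVal (covOp S) (j + 1) := fun j =>
    eigVal_anti hT (by omega) (by omega)
  set v := ∑ i : Fin r, ((eigVal (covOp S) (i + 1))⁻¹ * inner ℝ (S (f i)) y) • S (f i) with hv
  have hperp : ∀ i, inner ℝ (S (f i)) (y - v) = 0 := fun i => by
    rw [inner_sub_right, hv, inner_sum, Finset.sum_eq_single i]
    · rw [real_inner_smul_right, hf.inner_map_map, real_inner_self_eq_norm_sq,
        hf.orthonormal.1]
      field_simp [(hr0.trans_le (hle i)).ne']
      ring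
    · intro j _ hj
      rw [real_inner_smul_right, hf.inner_map_map, hf.orthonormal.2 hj.symm, mul_zero, mul_zero]
    · simp
  refine Submodule.eq_starProjection_of_mem_of_inner_eq_zero
    (Submodule.le_topologicalClosure _ ?_) ?_
  · refine Submodule.sum_mem _ fun i _ => Submodule.smul_mem _ _ (mem_eigenspaceGE (hle i) ?_)
    have : S.adjoint (S (f i)) = covOp S (f i) := rfl
    rw [ContinuousLinearMap.comp_apply, this, hf.eigen, map_smul]
  · have hsub : (eigenspaceGE (S ∘L S.adjoint) (eigVal (covOp S) r)).topologicalClosure ≤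
        (Submodule.span ℝ {y - v})ᗮ := by
      refine Submodule.topologicalClosure_minimal _ ?_ (Submodule.isClosed_orthogonal _)
      refine iSup₂_le fun s hs h hh => ?_
      rw [Submodule.mem_orthogonal_singleton_iff_inner_right]
      have hh' : S (S.adjoint h) = s • h := Module.End.mem_eigenspace_iff.1 hh
      have hs0 : 0 < s := hr0.trans_le hs
      have hg : covOp S (S.adjoint h) = s • S.adjoint h := by
        rw [covOp, ContinuousLinearMap.comp_apply, hh', map_smul]
      have h0 := hf.projOff_eq_zero hc (hlt.trans_le hs) hg
      rw [projOff_eq hf.orthonormal, sub_eq_zero] at h0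
      -- An eigenvector `h` of `S S^*` is recovered from `S^* h`, an eigenvector of `C` and hence in
      -- the span of `f`; so `h` lies in the span of the `S (f i)`.
      have h1 : h = s⁻¹ • S (S.adjoint h) := by rw [hh', smul_smul, inv_mul_cancel₀ hs0.ne', one_smul]
      rw [h1, real_inner_smul_right, h0, map_sum, inner_sum, Finset.sum_eq_zero, mul_zero]
      intro i _
      rw [map_smul, real_inner_smul_right, real_inner_comm (S (f i)), hperp, mul_zero]
    exact fun w hw => Submodule.mem_orthogonal_singleton_iff_inner_right.1 (hsub hw)

lemma mercerProj_comp (hf : IsLeadingEigensystem (covOp S) r f)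
    (hc : IsCompactOperator (covOp S))
    (hlt : eigVal (covOp S) (r + 1) < eigVal (covOp S) r)
    {G : Type*} [NormedAddCommGroup G] [InnerProductSpace ℝ G] (K : G →L[ℝ] F) :
    mercerProj S r ∘L K = S ∘L pinvOf (covOp S) f ∘L S.adjoint ∘L K := by
  ext1 x
  simp only [ContinuousLinearMap.comp_apply]
  rw [hf.mercerProj_apply hc hlt]
  simp [pinvOf, ContinuousLinearMap.adjoint_inner_right, smul_smul]

/-- `S` gains back half of the inverse: `‖S [C]_r^† x‖² = ⟨C [C]_r^† x, [C]_r^† x⟩ = ∑ λ_i⁻¹ ⟨f_i,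
x⟩²`, followed by Bessel's inequality. -/
lemma norm_comp_pinvOf_le (hf : IsLeadingEigensystem (covOp S) r f)
    (hr0 : 0 < eigVal (covOp S) r) :
    ‖S ∘L pinvOf (covOp S) f‖ ≤ 1 / √(eigVal (covOp S) r) := by
  have hle : ∀ j : Fin r, eigVal (covOp S) r ≤ eigVal (covOp S) (j + 1) := fun j =>
    eigVal_anti (isPositive_covOp S) (by omega) (by omega)
  refine ContinuousLinearMap.opNorm_le_bound _ (by positivity) fun x => ?_
  have h1 : pinvOf (covOp S) f x = ∑ i : Fin r, ((eigVal (covOp S) (i + 1))⁻¹ * inner ℝ (f i) x) • f i := by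
    simp [pinvOf, smul_smul]
  have h2 : covOp S (pinvOf (covOp S) f x) = ∑ i, inner ℝ (f i) x • f i := by
    rw [h1, map_sum]
    refine Finset.sum_congr rfl fun i _ => ?_
    rw [map_smul, hf.eigen, smul_smul]
    congr 1
    field_simp [(hr0.trans_le (hle i)).ne']
  have h3 : ∑ i, ‖inner ℝ (f i) x‖ ^ 2 ≤ ‖x‖ ^ 2 := hf.orthonormal.sum_inner_products_le x
  rw [ContinuousLinearMap.comp_apply, ← abs_norm,
    ← abs_of_nonneg (mul_nonneg (by positivity : 0 ≤ 1 / √(eigVal (covOp S) r)) (norm_nonneg x)),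
    ← sq_le_sq, ← real_inner_self_eq_norm_sq, ← inner_covOp, h2, h1, hf.orthonormal.inner_sum,
    mul_pow, div_pow, one_pow, Real.sq_sqrt hr0.le, one_div]
  calc _ ≤ ∑ i, (eigVal (covOp S) r)⁻¹ * ‖inner ℝ (f i) x‖ ^ 2 := by
        refine Finset.sum_le_sum fun i _ => ?_
        rw [Real.norm_eq_abs, sq_abs, conj_trivial]
        have h4 : (eigVal (covOp S) (i + 1))⁻¹ ≤ (eigVal (covOp S) r)⁻¹ :=
          inv_anti₀ hr0 (hle i)
        nlinarith [sq_nonneg (inner ℝ (f i) x)]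
    _ ≤ _ := by rw [← Finset.mul_sum]; gcongr

/-- The Mercer projection approximates the inclusion operator. -/
lemma norm_sub_mercerProj_comp_le (hf : IsLeadingEigensystem (covOp S) r f)
    (hc : IsCompactOperator (covOp S))
    (hlt : eigVal (covOp S) (r + 1) < eigVal (covOp S) r) :
    ‖S - mercerProj S r ∘L S‖ ≤ √(eigVal (covOp S) (r + 1)) := by
  refine ContinuousLinearMap.opNorm_le_bound _ (Real.sqrt_nonneg _) fun x => ?_
  have hle : ∀ j : Fin r, eigVal (covOp S) r ≤ eigVal (covOp S) (j + 1) := fun j =>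
    eigVal_anti (isPositive_covOp S) (by omega) (by omega)
  have hr0 : 0 < eigVal (covOp S) r := (eigVal_nonneg _ _).trans_lt hlt
  -- Projecting after `S` is projecting before it, so the squared norm becomes the form of `C` on
  -- the complement of `f`.
  have h1 : (S - mercerProj S r ∘L S) x = S (projOff f x) := by
    rw [_root_.sub_apply, ContinuousLinearMap.comp_apply, hf.mercerProj_apply hc hlt,
      projOff_eq hf.orthonormal, map_sub, map_sum]
    congr 1
    refine Finset.sum_congr rfl fun i _ => ?_
    rw [hf.inner_map_map, map_smul, inv_mul_cancel_left₀ (hr0.trans_le (hle i)).ne']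
  rw [h1, ← abs_norm,
    ← abs_of_nonneg (mul_nonneg (Real.sqrt_nonneg (eigVal (covOp S) (r + 1))) (norm_nonneg x)),
    ← sq_le_sq, mul_pow, Real.sq_sqrt (eigVal_nonneg _ _), ← real_inner_self_eq_norm_sq,
    ← inner_covOp]
  refine (hf.inner_le (isPositive_covOp S) hc (inner_projOff f x)).trans ?_
  have := norm_projOff_le f x
  have := eigVal_nonneg (covOp S) (r + 1)
  gcongr

/-- The error of the truncated estimator in terms of the errors of the covariance operators. -/
lemma norm_mercerProj_comp_sub_le (hf : IsLeadingEigensystem (covOp S) r f)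
    (hc : IsCompactOperator (covOp S)) (hr : 1 ≤ r)
    {G : Type*} [NormedAddCommGroup G] [InnerProductSpace ℝ G] (K : G →L[ℝ] F)
    {T' A : E →L[ℝ] E} (hT' : T'.IsPositive) (hc' : IsCompactOperator T')
    (hA : IsTruncatedPinv T' r A) (B : G →L[ℝ] E) {η d : ℝ} (hd : 0 < d) (hηd : η ≤ d)
    (hη : ‖covOp S - T'‖ ≤ η) (hB : ‖S.adjoint ∘L K - B‖ ≤ η)
    (hgap : ∀ j : Fin r, 2 * d ≤ eigVal (covOp S) (j + 1) - eigVal (covOp S) (j + 2)) :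
    ‖mercerProj S r ∘L K - S ∘L A ∘L B‖ ≤ 1 / √(eigVal (covOp S) r) * η +
      ‖S‖ * ((r + 1) / (d * eigVal (covOp S) r) * η) * ‖B‖ := by
  obtain ⟨f', hf', rfl⟩ := hA
  have hlt : eigVal (covOp S) (r + 1) < eigVal (covOp S) r := by
    have h := hgap ⟨r - 1, by omega⟩
    have e : r - 1 + 2 = r + 1 := by omega
    simp only [Nat.sub_add_cancel hr, e] at h
    linarith
  have hr0 : 0 < eigVal (covOp S) r := (eigVal_nonneg _ _).trans_lt hlt
  have h1 := hf.norm_comp_pinvOf_le hr0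
  have h2 := hf.norm_pinvOf_sub_le hf' (isPositive_covOp S) hT' hc hc' hd hηd hη hgap hr
  have hsplit : mercerProj S r ∘L K - S ∘L pinvOf T' f' ∘L B =
      (S ∘L pinvOf (covOp S) f) ∘L (S.adjoint ∘L K - B) +
        S ∘L (pinvOf (covOp S) f - pinvOf T' f') ∘L B := by
    rw [hf.mercerProj_comp hc hlt]
    ext1 x
    simp only [_root_.sub_apply, _root_.add_apply, ContinuousLinearMap.comp_apply, map_sub]
    abel
  change ‖mercerProj S r ∘L K - S ∘L pinvOf T' f' ∘L B‖ ≤ _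
  rw [hsplit]
  refine (norm_add_le _ _).trans (add_le_add ?_ ?_)
  · refine (ContinuousLinearMap.opNorm_comp_le _ _).trans ?_
    gcongr
  · refine (ContinuousLinearMap.opNorm_comp_le _ _).trans ?_
    rw [mul_assoc]
    gcongr
    refine (ContinuousLinearMap.opNorm_comp_le _ _).trans ?_
    gcongr

end IsLeadingEigensystem

end Mercer

/-! ### A Bernstein inequality in Hilbert space via hyperbolic cosines. -/

section Concentration

lemma stronglyMeasurable_sum_comp {W Z : Type*} [NormedAddCommGroup W] [MeasurableSpace Z]
    {d : Z → W} (hd : StronglyMeasurable d) (n : ℕ) :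
    StronglyMeasurable fun z : Fin n → Z => ∑ i, d (z i) :=
  Finset.stronglyMeasurable_fun_sum _ fun i _ => hd.comp_measurable (measurable_pi_apply i)

lemma integrable_cosh_norm {W Z : Type*} [NormedAddCommGroup W] [MeasurableSpace Z]
    {ν : Measure Z} [IsFiniteMeasure ν] {g : Z → W} (hg : StronglyMeasurable g) {C : ℝ} (hC : ∀ w, ‖g w‖ ≤ C) :
    Integrable (fun w => Real.cosh ‖g w‖) ν := by
  refine Integrable.of_bound
    (Real.continuous_cosh.comp_stronglyMeasurable hg.norm).aestronglyMeasurable (Real.cosh C)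
    (ae_of_all _ fun w => ?_)
  rw [Real.norm_of_nonneg (Real.cosh_pos _).le, Real.cosh_le_cosh, abs_norm]
  exact (hC w).trans (le_abs_self C)

variable {V : Type*} [NormedAddCommGroup V] [InnerProductSpace ℝ V]

/-- As a function of the square of its argument, `cosh` is a power series with nonnegative
coefficients, hence convex on `[0, ∞)`; the inequality holds term by term. -/
lemma cosh_le_of_sq_eq {s a b θ : ℝ} (h0 : 0 ≤ θ) (h1 : θ ≤ 1)
    (h : s ^ 2 = θ * a ^ 2 + (1 - θ) * b ^ 2) :
    Real.cosh s ≤ θ * Real.cosh a + (1 - θ) * Real.cosh b := by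
  refine hasSum_le (fun n => ?_) (Real.hasSum_cosh s)
    (((Real.hasSum_cosh a).mul_left θ).add ((Real.hasSum_cosh b).mul_left (1 - θ)))
  have hconv := (convexOn_pow (𝕜 := ℝ) n).2 (x := a ^ 2) (sq_nonneg a) (y := b ^ 2) (sq_nonneg b)
    h0 (sub_nonneg.2 h1) (by ring)
  simp only [smul_eq_mul] at hconv
  rw [← h] at hconv
  rw [pow_mul, pow_mul, pow_mul, ← mul_div_assoc, ← mul_div_assoc, ← add_div]
  gcongr

/-- With `q` the cosine of the angle, `‖x + d‖²` is the convex combination of `(‖x‖ + ‖d‖)²` and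
`(‖x‖ - ‖d‖)²` with weights `(1 ± q)/2`. -/
lemma cosh_norm_add_le_of_ne_zero {x d : V} (hx : x ≠ 0) (hd : d ≠ 0) :
    Real.cosh ‖x + d‖ ≤ Real.cosh ‖x‖ * Real.cosh ‖d‖ +
      inner ℝ x d / (‖x‖ * ‖d‖) * (Real.sinh ‖x‖ * Real.sinh ‖d‖) := by
  have hxp : 0 < ‖x‖ := norm_pos_iff.2 hx
  have hdp : 0 < ‖d‖ := norm_pos_iff.2 hd
  have hab := abs_le.1 (abs_real_inner_div_norm_mul_norm_le_one x d)
  set q := inner ℝ x d / (‖x‖ * ‖d‖) with hq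
  have hin : inner ℝ x d = q * (‖x‖ * ‖d‖) := by rw [hq]; field_simp
  have h := cosh_le_of_sq_eq (s := ‖x + d‖) (a := ‖x‖ + ‖d‖) (b := ‖x‖ - ‖d‖) (θ := (1 + q) / 2)
    (by linarith) (by linarith) (by rw [norm_add_sq_real, hin]; ring)
  rw [Real.cosh_add, Real.cosh_sub] at h
  linarith

/-- One step of the exponential supermartingale for sums of centred vectors. -/
lemma cosh_norm_add_le (x : V) {d : V} (hd : ‖d‖ ≤ 1) :
    Real.cosh ‖x + d‖ ≤
      Real.cosh ‖x‖ * (1 + ‖d‖ ^ 2) + Real.sinh ‖x‖ / ‖x‖ * inner ℝ x d := by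
  have hexp : Real.cosh ‖d‖ + Real.sinh ‖d‖ - ‖d‖ ≤ 1 + ‖d‖ ^ 2 := by
    rw [Real.cosh_add_sinh]
    have := (abs_le.1 (Real.abs_exp_sub_one_sub_id_le (x := ‖d‖) (by rwa [abs_norm]))).2
    linarith
  have hsd : ‖d‖ ≤ Real.sinh ‖d‖ := Real.self_le_sinh_iff.2 (norm_nonneg d)
  have hcx := Real.one_le_cosh ‖x‖
  rcases eq_or_ne x 0 with rfl | hx
  · simp only [zero_add, norm_zero, Real.cosh_zero, inner_zero_left, mul_zero, add_zero, one_mul]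
    linarith
  rcases eq_or_ne d 0 with rfl | hd0
  · simp
  refine (cosh_norm_add_le_of_ne_zero hx hd0).trans ?_
  have hxp : 0 < ‖x‖ := norm_pos_iff.2 hx
  have hdp : 0 < ‖d‖ := norm_pos_iff.2 hd0
  have hq := (abs_le.1 (abs_real_inner_div_norm_mul_norm_le_one x d)).2
  set q := inner ℝ x d / (‖x‖ * ‖d‖) with hq'
  have hin : inner ℝ x d = q * (‖x‖ * ‖d‖) := by rw [hq']; field_simp
  have hsx : 0 ≤ Real.sinh ‖x‖ := Real.sinh_nonneg_iff.2 (norm_nonneg x)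
  have hsc : Real.sinh ‖x‖ ≤ Real.cosh ‖x‖ := (Real.sinh_lt_cosh _).le
  have e : Real.sinh ‖x‖ / ‖x‖ * inner ℝ x d = q * (Real.sinh ‖x‖ * ‖d‖) := by
    rw [hin]; field_simp
  rw [e]
  -- Only the excess `sinh ‖d‖ - ‖d‖` is estimated crudely. The part linear in `d` is kept exactly,
  -- since it averages to zero for centred `d`.
  have h1 : q * (Real.sinh ‖x‖ * (Real.sinh ‖d‖ - ‖d‖)) ≤
      1 * (Real.cosh ‖x‖ * (Real.sinh ‖d‖ - ‖d‖)) := by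
    refine (mul_le_mul_of_nonneg_right hq
      (mul_nonneg hsx (sub_nonneg.2 hsd))).trans ?_
    exact mul_le_mul_of_nonneg_left (mul_le_mul_of_nonneg_right hsc (sub_nonneg.2 hsd)) zero_le_one
  have h2 := mul_le_mul_of_nonneg_left hexp (zero_le_one.trans hcx)
  linarith

variable [CompleteSpace V] {Z : Type*} [MeasurableSpace Z] {π : Measure Z} [IsProbabilityMeasure π]

/-- Integrating out one sample kills the linear term of `cosh_norm_add_le` and costs a factor `1 +
τ`. The starting point `x` is arbitrary so that the induction can absorb the first sample into it.
-/
lemma integral_cosh_norm_le {d : Z → V} (hd : StronglyMeasurable d) (hd1 : ∀ z, ‖d z‖ ≤ 1)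
    (hmean : ∫ z, d z ∂π = 0) {τ : ℝ} (hτ : ∫ z, ‖d z‖ ^ 2 ∂π ≤ τ) (n : ℕ) (x : V) :
    ∫ z : Fin n → Z, Real.cosh ‖x + ∑ i, d (z i)‖ ∂(Measure.pi fun _ => π) ≤
      Real.cosh ‖x‖ * (1 + τ) ^ n := by
  have hτ0 : 0 ≤ τ := (integral_nonneg fun z => sq_nonneg _).trans hτ
  have hsum : ∀ (n : ℕ) (z : Fin n → Z), ‖∑ i, d (z i)‖ ≤ n := fun n z => by
    refine (norm_sum_le _ _).trans ((Finset.sum_le_sum fun i _ => hd1 (z i)).trans ?_)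
    simp
  have hint : ∀ x : V, Integrable (fun z => Real.cosh ‖x + d z‖) π := fun x =>
    integrable_cosh_norm (stronglyMeasurable_const.add hd) (C := ‖x‖ + 1) fun z =>
      (norm_add_le _ _).trans (by gcongr; exact hd1 z)
  have hd2 : Integrable (fun z => ‖d z‖ ^ 2) π := by
    refine Integrable.of_bound (hd.norm.pow 2).aestronglyMeasurable 1 (ae_of_all _ fun z => ?_)
    rw [Real.norm_of_nonneg (sq_nonneg _)]
    exact pow_le_one₀ (norm_nonneg _) (hd1 z)
  have hdi : Integrable d π := Integrable.of_bound hd.aestronglyMeasurable 1 (ae_of_all _ hd1)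
  have hone : ∀ x : V, ∫ z, Real.cosh ‖x + d z‖ ∂π ≤ Real.cosh ‖x‖ * (1 + τ) := fun x => by
    have hi1 : Integrable (fun z => Real.cosh ‖x‖ * (1 + ‖d z‖ ^ 2)) π :=
      ((integrable_const 1).add hd2).const_mul _
    have hi2 : Integrable (fun z => Real.sinh ‖x‖ / ‖x‖ * inner ℝ x (d z)) π :=
      (hdi.const_inner x).const_mul _
    calc ∫ z, Real.cosh ‖x + d z‖ ∂π
        ≤ ∫ z, (Real.cosh ‖x‖ * (1 + ‖d z‖ ^ 2) + Real.sinh ‖x‖ / ‖x‖ * inner ℝ x (d z)) ∂π :=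
          integral_mono (hint x) (hi1.add hi2) fun z => cosh_norm_add_le x (hd1 z)
      _ = Real.cosh ‖x‖ * (1 + ∫ z, ‖d z‖ ^ 2 ∂π) := by
          rw [integral_add hi1 hi2, integral_const_mul, integral_const_mul, integral_inner hdi,
            hmean, inner_zero_right, mul_zero, add_zero, integral_add (integrable_const 1) hd2]
          simp
      _ ≤ _ := by have := Real.cosh_pos ‖x‖; gcongr
  induction n generalizing x with
  | zero => simp
  | succ n ih =>
    have hmp := measurePreserving_piFinSuccAbove (fun _ : Fin (n + 1) => π) 0
    have hg : StronglyMeasurable fun p : Z × (Fin n → Z) => x + d p.1 + ∑ i, d (p.2 i) :=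
      (stronglyMeasurable_const.add (hd.comp_measurable measurable_fst)).add
        ((stronglyMeasurable_sum_comp hd n).comp_measurable measurable_snd)
    have hgi : Integrable (fun p : Z × (Fin n → Z) => Real.cosh ‖x + d p.1 + ∑ i, d (p.2 i)‖)
        (π.prod (Measure.pi fun _ => π)) :=
      integrable_cosh_norm hg (C := ‖x‖ + 1 + n) fun p =>
        (norm_add_le _ _).trans (add_le_add ((norm_add_le _ _).trans
          (by gcongr; exact hd1 _)) (hsum n p.2))
    calc ∫ z : Fin (n + 1) → Z, Real.cosh ‖x + ∑ i, d (z i)‖ ∂(Measure.pi fun _ => π)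
        = ∫ p : Z × (Fin n → Z), Real.cosh ‖x + d p.1 + ∑ i, d (p.2 i)‖
            ∂(π.prod (Measure.pi fun _ => π)) := by
          rw [← hmp.integral_comp' (g := fun p : Z × (Fin n → Z) =>
            Real.cosh ‖x + d p.1 + ∑ i, d (p.2 i)‖)]
          refine integral_congr_ae (ae_of_all _ fun z => ?_)
          simp only [Fin.sum_univ_succ, ← add_assoc]
          rfl
      _ = ∫ z₀, ∫ z : Fin n → Z, Real.cosh ‖x + d z₀ + ∑ i, d (z i)‖
            ∂(Measure.pi fun _ => π) ∂π := integral_prod _ hgi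
      _ ≤ ∫ z₀, Real.cosh ‖x + d z₀‖ * (1 + τ) ^ n ∂π :=
          integral_mono hgi.integral_prod_left ((hint x).mul_const _) fun z₀ => ih (x + d z₀)
      _ ≤ Real.cosh ‖x‖ * (1 + τ) ^ (n + 1) := by
          rw [integral_mul_const, pow_succ', ← mul_assoc]
          gcongr
          exact hone x

/-- A Bernstein inequality for sums of independent centred vectors in a Hilbert space. -/
lemma measureReal_norm_sum_ge_le {d : Z → V} (hd : StronglyMeasurable d) {b : ℝ}
    (hdb : ∀ z, ‖d z‖ ≤ b) (hmean : ∫ z, d z ∂π = 0) {v : ℝ} (hv : ∫ z, ‖d z‖ ^ 2 ∂π ≤ v)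
    {l : ℝ} (hl : 0 ≤ l) (hlb : l * b ≤ 1) (n : ℕ) (s : ℝ) :
    (Measure.pi fun _ : Fin n => π).real {z | s ≤ ‖∑ i, d (z i)‖} ≤
      2 * Real.exp (n * (l ^ 2 * v) - l * s) := by
  set e : Z → V := fun z => l • d z with he
  have hes : StronglyMeasurable e := hd.const_smul l
  have hnorm : ∀ z, ‖e z‖ = l * ‖d z‖ := fun z => by rw [he, norm_smul, Real.norm_of_nonneg hl]
  have he1 : ∀ z, ‖e z‖ ≤ 1 := fun z => by
    rw [hnorm]; exact (mul_le_mul_of_nonneg_left (hdb z) hl).trans hlb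
  have hem : ∫ z, e z ∂π = 0 := by rw [he, integral_smul, hmean, smul_zero]
  have hev : ∫ z, ‖e z‖ ^ 2 ∂π ≤ l ^ 2 * v := by
    simp only [hnorm, mul_pow]
    rw [integral_const_mul]
    gcongr
  have hv0 : 0 ≤ l ^ 2 * v := (integral_nonneg fun z => sq_nonneg _).trans hev
  have h1 := integral_cosh_norm_le hes he1 hem hev n 0
  simp only [zero_add, norm_zero, Real.cosh_zero, one_mul] at h1
  have hsum : ∀ z : Fin n → Z, ∑ i, e (z i) = l • ∑ i, d (z i) := fun z => by
    rw [he, Finset.smul_sum]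
  have h2 : (1 + l ^ 2 * v) ^ n ≤ Real.exp (n * (l ^ 2 * v)) := by
    rw [Real.exp_nat_mul]
    gcongr
    linarith [Real.add_one_le_exp (l ^ 2 * v)]
  have hi : Integrable (fun z : Fin n → Z => Real.cosh ‖∑ i, e (z i)‖)
      (Measure.pi fun _ : Fin n => π) := by
    refine integrable_cosh_norm (stronglyMeasurable_sum_comp hes n) (C := n) fun z => ?_
    refine (norm_sum_le _ _).trans ((Finset.sum_le_sum fun i _ => he1 (z i)).trans ?_)
    simp
  have h3 := mul_meas_ge_le_integral_of_nonneg (ae_of_all _ fun z => (Real.cosh_pos _).le) hi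
    (Real.exp (l * s) / 2)
  -- Markov's inequality is applied to `cosh u ≥ exp u / 2`; hence the factor `2` in the tail.
  have hsub : {z : Fin n → Z | s ≤ ‖∑ i, d (z i)‖} ⊆
      {z | Real.exp (l * s) / 2 ≤ Real.cosh ‖∑ i, e (z i)‖} := fun z hz => by
    have h4 : l * s ≤ ‖∑ i, e (z i)‖ := by
      rw [hsum, norm_smul, Real.norm_of_nonneg hl]
      exact mul_le_mul_of_nonneg_left hz hl
    have h5 := Real.exp_le_exp.2 h4
    have h6 := Real.exp_pos (-‖∑ i, e (z i)‖)
    simp only [mem_ofPred_eq, Real.cosh_eq]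
    linarith
  have h7 := measureReal_mono (μ := Measure.pi fun _ : Fin n => π) hsub
  have h8 : Real.exp (l * s) / 2 * (Measure.pi fun _ : Fin n => π).real
      {z | s ≤ ‖∑ i, d (z i)‖} ≤ Real.exp (n * (l ^ 2 * v)) :=
    (mul_le_mul_of_nonneg_left h7 (by positivity)).trans (h3.trans (h1.trans h2))
  rw [Real.exp_sub, ← mul_div_assoc, le_div_iff₀ (Real.exp_pos _)]
  linarith

end Concentration

/-! ### Concentration of empirical rank-one operators. -/

section OperatorConcentration

open scoped TensorProduct

variable {H₁ H₂ : Type*} [NormedAddCommGroup H₁] [InnerProductSpace ℝ H₁]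
  [NormedAddCommGroup H₂] [InnerProductSpace ℝ H₂]
  {Z : Type*} [MeasurableSpace Z] {π : Measure Z} [IsProbabilityMeasure π]

lemma norm_le_of_forall_inner_le {A : H₂ →L[ℝ] H₁} {η : ℝ} (hη : 0 ≤ η)
    (h : ∀ u v, inner ℝ u (A v) ≤ η * (‖u‖ * ‖v‖)) : ‖A‖ ≤ η := by
  refine ContinuousLinearMap.opNorm_le_bound _ hη fun v => ?_
  rcases eq_or_ne (A v) 0 with h0 | h0
  · rw [h0, norm_zero]; positivity
  · have h1 := h (A v) v
    rw [real_inner_self_eq_norm_sq] at h1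
    exact le_of_mul_le_mul_right (a := ‖A v‖) (by nlinarith) (norm_pos_iff.2 h0)

/-- Concentration of empirical means of rank-one operators in operator norm. -/
lemma exists_measurableSet_norm_sub_empirical_le {p : Z → H₁} {q : Z → H₂}
    (hp : StronglyMeasurable p) (hq : StronglyMeasurable q) {κ N : ℝ} (hκ : 0 < κ) (hN : 0 < N)
    (hpq : ∀ z, ‖p z‖ * ‖q z‖ ≤ κ) (hvar : ∫ z, (‖p z‖ * ‖q z‖) ^ 2 ∂π ≤ κ * N)
    {B : H₂ →L[ℝ] H₁}
    (hB : ∀ u v, inner ℝ u (B v) = ∫ z, inner ℝ (p z) u * inner ℝ (q z) v ∂π)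
    {η : ℝ} (hη : 0 ≤ η) (hηN : η ≤ N) {n : ℕ} (hn : 1 ≤ n) :
    ∃ G : Set (Fin n → Z), MeasurableSet G ∧
      (Measure.pi fun _ : Fin n => π).real Gᶜ ≤ 2 * Real.exp (-(n * η ^ 2 / (4 * (κ * N)))) ∧
      ∀ z ∈ G, ‖B - (n : ℝ)⁻¹ • ∑ i, InnerProductSpace.rankOne ℝ (p (z i)) (q (z i))‖ ≤ η := by
  -- The completed tensor product plays the role of the Hilbert–Schmidt operators: a Hilbert space
  -- in which Bernstein applies. Pairing with `u ⊗ v` recovers matrix entries, so its norm dominates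
  -- the operator norm.
  let F : Z → UniformSpace.Completion (H₁ ⊗[ℝ] H₂) := fun z => ((p z ⊗ₜ[ℝ] q z : H₁ ⊗[ℝ] H₂))
  have hF : StronglyMeasurable F :=
    ((UniformSpace.Completion.continuous_coe _).comp
      TensorProduct.continuous_tmul).comp_stronglyMeasurable (hp.prodMk hq)
  have hFn : ∀ z, ‖F z‖ = ‖p z‖ * ‖q z‖ := fun z => by
    rw [UniformSpace.Completion.norm_coe, TensorProduct.norm_tmul]
  have hFi : Integrable F π := Integrable.of_bound hF.aestronglyMeasurable κ
    (ae_of_all _ fun z => (hFn z).trans_le (hpq z))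
  set M := ∫ z, F z ∂π with hM
  have hMn : ‖M‖ ≤ κ := by
    simpa using norm_integral_le_of_norm_le_const (μ := π)
      (ae_of_all _ fun z => (hFn z).trans_le (hpq z))
  let d : Z → UniformSpace.Completion (H₁ ⊗[ℝ] H₂) := fun z => F z - M
  have hd : StronglyMeasurable d := hF.sub stronglyMeasurable_const
  have hdb : ∀ z, ‖d z‖ ≤ 2 * κ := fun z =>
    (norm_sub_le _ _).trans (by linarith [(hFn z).trans_le (hpq z)])
  have hdm : ∫ z, d z ∂π = 0 := by
    rw [integral_sub hFi (integrable_const M)]; simp [← hM]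
  have hF2 : Integrable (fun z => ‖F z‖ ^ 2) π := by
    refine Integrable.of_bound (hF.norm.pow 2).aestronglyMeasurable (κ ^ 2)
      (ae_of_all _ fun z => ?_)
    rw [Real.norm_of_nonneg (sq_nonneg _)]
    gcongr
    exact (hFn z).trans_le (hpq z)
  have hdv : ∫ z, ‖d z‖ ^ 2 ∂π ≤ κ * N := by
    have h1 : ∀ z, ‖d z‖ ^ 2 = ‖F z‖ ^ 2 - 2 * inner ℝ M (F z) + ‖M‖ ^ 2 := fun z => by
      rw [norm_sub_sq_real, real_inner_comm]
    have h2 : Integrable (fun z => 2 * inner ℝ M (F z)) π := (hFi.const_inner M).const_mul 2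
    have h3 : Integrable (fun z => ‖F z‖ ^ 2 - 2 * inner ℝ M (F z)) π := hF2.sub h2
    simp only [h1]
    rw [integral_add h3 (integrable_const _), integral_sub hF2 h2, integral_const_mul,
      integral_inner hFi, ← hM, real_inner_self_eq_norm_sq]
    simp only [hFn] at hvar ⊢
    simp only [integral_const, probReal_univ, one_smul]
    nlinarith [sq_nonneg ‖M‖]
  refine ⟨{z | ‖∑ i, d (z i)‖ < n * η}, ?_, ?_, fun z hz => ?_⟩
  · exact (stronglyMeasurable_sum_comp hd n).norm.measurable measurableSet_Iio
  -- This `l` minimises the exponent `n l² κN - l n η`, with value `-n η² / (4κN)`; the constraint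
  -- `l · 2κ ≤ 1` is precisely `η ≤ N`.
  · have h1 := measureReal_norm_sum_ge_le hd hdb hdm hdv (l := η / (2 * (κ * N)))
      (by positivity) (by
        rw [div_mul_eq_mul_div, div_le_one (by positivity)]
        nlinarith) n (n * η)
    have h2 : {z : Fin n → Z | ‖∑ i, d (z i)‖ < n * η}ᶜ = {z | n * η ≤ ‖∑ i, d (z i)‖} := by
      ext z; simp
    rw [h2]
    refine h1.trans_eq ?_
    congr 2
    field_simp
    ring
  · have hn0 : (0 : ℝ) < n := by exact_mod_cast hn
    refine norm_le_of_forall_inner_le hη fun u v => ?_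
    let w : UniformSpace.Completion (H₁ ⊗[ℝ] H₂) := ((u ⊗ₜ[ℝ] v : H₁ ⊗[ℝ] H₂))
    have hwn : ‖w‖ = ‖u‖ * ‖v‖ := by
      rw [UniformSpace.Completion.norm_coe, TensorProduct.norm_tmul]
    have hFw : ∀ z, inner ℝ (F z) w = inner ℝ (p z) u * inner ℝ (q z) v := fun z => by
      rw [UniformSpace.Completion.inner_coe, TensorProduct.inner_tmul]
    have hMw : inner ℝ M w = inner ℝ u (B v) := by
      rw [hB, real_inner_comm, hM, ← integral_inner hFi]
      exact integral_congr_ae (ae_of_all _ fun z => by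
        simp only; rw [real_inner_comm, hFw])
    have hsum : inner ℝ (∑ i, d (z i)) w =
        ∑ i, inner ℝ (p (z i)) u * inner ℝ (q (z i)) v - n * inner ℝ u (B v) := by
      rw [sum_inner, ← hMw]
      simp only [d, inner_sub_left, hFw, Finset.sum_sub_distrib, Finset.sum_const,
        Finset.card_univ, Fintype.card_fin, nsmul_eq_mul]
    have h1 : inner ℝ u ((B - (n : ℝ)⁻¹ •
        ∑ i, InnerProductSpace.rankOne ℝ (p (z i)) (q (z i))) v) =
        -((n : ℝ)⁻¹ * inner ℝ (∑ i, d (z i)) w) := by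
      rw [hsum, _root_.sub_apply, inner_sub_right, _root_.smul_apply, real_inner_smul_right,
        _root_.sum_apply, inner_sum]
      simp only [InnerProductSpace.rankOne_apply, real_inner_smul_right,
        real_inner_comm u, mul_comm (inner ℝ (q _) v)]
      field_simp
      ring
    rw [h1, ← mul_neg, ← inner_neg_left]
    calc _ ≤ (n : ℝ)⁻¹ * (‖-∑ i, d (z i)‖ * ‖w‖) := by gcongr; exact real_inner_le_norm _ _
      _ ≤ (n : ℝ)⁻¹ * (n * η * ‖w‖) := by rw [norm_neg]; gcongr; exact le_of_lt hz
      _ = _ := by rw [hwn]; field_simp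

end OperatorConcentration

/-! ### Compactness of finite-rank operators. -/

section CompactOperators

variable {E F : Type*} [NormedAddCommGroup E] [InnerProductSpace ℝ E]
  [NormedAddCommGroup F] [InnerProductSpace ℝ F]

lemma isCompactOperator_rankOne (x : E) (y : F) :
    IsCompactOperator (InnerProductSpace.rankOne ℝ x y) := by
  have h : IsCompactOperator (innerSL ℝ y) := isCompactOperator_of_locallyCompactSpace_dom _
  exact h.clm_comp (ContinuousLinearMap.toSpanSingleton ℝ x)

lemma isCompactOperator_smul_sum_rankOne {ι : Type*} (s : Finset ι) (c : ℝ) (x : ι → E) (y : ι → F) :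
    IsCompactOperator (c • ∑ i ∈ s, InnerProductSpace.rankOne ℝ (x i) (y i)) :=
  (compactOperator (RingHom.id ℝ) F E).smul_mem c
    (Submodule.sum_mem _ fun i _ => isCompactOperator_rankOne (x i) (y i))

end CompactOperators

/-! ### Empirical covariance and cross-covariance. -/

section Empirical

variable {α β : Type*} {HX HY : Type*}
  [NormedAddCommGroup HX] [InnerProductSpace ℝ HX] [CompleteSpace HX] [RKHS ℝ HX α ℝ]
  [NormedAddCommGroup HY] [InnerProductSpace ℝ HY] [CompleteSpace HY] [RKHS ℝ HY β ℝ]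

lemma isCompactOperator_empCov {m : ℕ} (z : Fin m → α × β) : IsCompactOperator (empCov HX z) :=
  isCompactOperator_smul_sum_rankOne _ _ _ _

lemma isPositive_empCov {m : ℕ} (z : Fin m → α × β) : (empCov HX z).IsPositive :=
  (ContinuousLinearMap.isPositive_sum _ fun _ _ =>
    InnerProductSpace.isPositive_rankOne_self _).smul_of_nonneg (by positivity)

lemma inner_empCross {m : ℕ} (z : Fin m → α × β) (u : HX) (v : HY) :
    inner ℝ u (empCross HX HY z v) = (m : ℝ)⁻¹ * ∑ i, u (z i).1 * v (z i).2 := by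
  rw [empCross, _root_.smul_apply, real_inner_smul_right, _root_.sum_apply, inner_sum]
  congr 1
  refine Finset.sum_congr rfl fun i _ => ?_
  rw [InnerProductSpace.rankOne_apply, real_inner_smul_right, real_inner_comm v, feature_inner,
    feature_inner, mul_comm]

lemma inner_empCov {m : ℕ} (z : Fin m → α × β) (u : HX) :
    inner ℝ u (empCov HX z u) = (m : ℝ)⁻¹ * ∑ i, u (z i).1 ^ 2 := by
  rw [empCov, _root_.smul_apply, real_inner_smul_right, _root_.sum_apply, inner_sum]
  congr 1
  refine Finset.sum_congr rfl fun i _ => ?_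
  rw [InnerProductSpace.rankOne_apply, real_inner_smul_right, real_inner_comm u, feature_inner, sq]

/-- The empirical cross-covariance is controlled by the empirical covariance. -/
lemma norm_empCross_le {m : ℕ} (z : Fin m → α × β) {κ : ℝ} (hκ : 0 ≤ κ)
    (hbd : ∀ (v : HY) (y : β), v y ^ 2 ≤ κ * ‖v‖ ^ 2) :
    ‖empCross HX HY z‖ ≤ √(‖empCov HX z‖ * κ) := by
  refine norm_le_of_forall_inner_le (Real.sqrt_nonneg _) fun u v => ?_
  refine le_trans (le_abs_self _) (abs_le_of_sq_le_sq ?_ (by positivity))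
  have h1 : inner ℝ u (empCov HX z u) ≤ ‖empCov HX z‖ * ‖u‖ ^ 2 := by
    rw [real_inner_comm]; exact inner_map_self_le _ u
  have h2 : (m : ℝ)⁻¹ * ∑ i, v (z i).2 ^ 2 ≤ κ * ‖v‖ ^ 2 := by
    calc _ ≤ (m : ℝ)⁻¹ * ∑ _i : Fin m, κ * ‖v‖ ^ 2 := by gcongr; exact hbd v _
      _ = ((m : ℝ)⁻¹ * m) * (κ * ‖v‖ ^ 2) := by simp [mul_assoc]
      _ ≤ 1 * (κ * ‖v‖ ^ 2) := by gcongr; exact inv_mul_le_one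
      _ = _ := one_mul _
  calc inner ℝ u (empCross HX HY z v) ^ 2
      = (m : ℝ)⁻¹ ^ 2 * (∑ i, u (z i).1 * v (z i).2) ^ 2 := by rw [inner_empCross, mul_pow]
    -- Cauchy–Schwarz over the samples: only the factor from `v` is bounded uniformly, the other
    -- stays a form of the empirical covariance.
    _ ≤ (m : ℝ)⁻¹ ^ 2 * ((∑ i, u (z i).1 ^ 2) * ∑ i, v (z i).2 ^ 2) := by
        gcongr; exact Finset.sum_mul_sq_le_sq_mul_sq _ _ _
    _ = inner ℝ u (empCov HX z u) * ((m : ℝ)⁻¹ * ∑ i, v (z i).2 ^ 2) := by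
        rw [inner_empCov]; ring
    _ ≤ (‖empCov HX z‖ * ‖u‖ ^ 2) * (κ * ‖v‖ ^ 2) := by
        gcongr
    _ = (√(‖empCov HX z‖ * κ) * (‖u‖ * ‖v‖)) ^ 2 := by
        rw [mul_pow, Real.sq_sqrt (by positivity)]; ring

end Empirical

/-! ### The inclusion operator and its covariance. -/

section Inclusion

lemma kernel_diag_nonneg {α H : Type*} [NormedAddCommGroup H] [InnerProductSpace ℝ H]
    [CompleteSpace H] [RKHS ℝ H α ℝ] {k : α → α → ℝ} (hH : IsRKHSOf H k) (x : α) : 0 ≤ k x x := by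
  rw [← norm_feature_sq hH]; positivity

lemma sq_apply_le {α H : Type*} [NormedAddCommGroup H] [InnerProductSpace ℝ H]
    [CompleteSpace H] [RKHS ℝ H α ℝ] {k : α → α → ℝ} (hH : IsRKHSOf H k) (f : H) (x : α) :
    f x ^ 2 ≤ k x x * ‖f‖ ^ 2 := by
  rw [← norm_feature_sq hH, ← feature_inner, ← sq_abs, ← mul_pow, mul_comm ‖feature H x‖]
  gcongr
  exact abs_real_inner_le_norm _ _

lemma integrable_diag {α : Type*} [TopologicalSpace α] [MeasurableSpace α] [BorelSpace α]
    {k : α → α → ℝ} (hk : IsBoundedContinuousKernel k) (ν : Measure α) [IsFiniteMeasure ν] :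
    Integrable (fun x => k x x) ν := by
  obtain ⟨C, hC⟩ := hk.bounded
  have hc : Continuous fun x => k x x := hk.continuous.comp (continuous_id.prodMk continuous_id)
  exact Integrable.of_bound hc.measurable.aestronglyMeasurable C (ae_of_all _ fun x => hC x x)

variable {α : Type*} [TopologicalSpace α] [MeasurableSpace α] [BorelSpace α]
  {H : Type*} [NormedAddCommGroup H] [InnerProductSpace ℝ H] [CompleteSpace H] [RKHS ℝ H α ℝ]
  {k : α → α → ℝ} (hk : IsBoundedContinuousKernel k) (hH : IsRKHSOf H k)
  (ν : Measure α)

variable [IsFiniteMeasure ν]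

lemma coeFn_inclusion (f : H) : inclusion hk hH ν f =ᵐ[ν] f :=
  (memLp_coe hk hH ν f).coeFn_toLp

lemma inner_inclusion (f : H) (g : Lp ℝ 2 ν) :
    inner ℝ (inclusion hk hH ν f) g = ∫ x, f x * g x ∂ν := by
  rw [L2.inner_def]
  refine integral_congr_ae ?_
  filter_upwards [coeFn_inclusion hk hH ν f] with x hx
  rw [hx, real_inner_eq_re_inner, RCLike.inner_apply, conj_trivial, mul_comm]
  rfl

lemma inner_covOp_inclusion (f g : H) :
    inner ℝ f (covOp (inclusion hk hH ν) g) = ∫ x, f x * g x ∂ν := by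
  rw [real_inner_comm, inner_covOp, real_inner_comm, inner_inclusion]
  refine integral_congr_ae ?_
  filter_upwards [coeFn_inclusion hk hH ν g] with x hx
  rw [hx]

lemma norm_inclusion_le : ‖inclusion hk hH ν‖ ≤ √(diagNorm k ν) := by
  refine ContinuousLinearMap.opNorm_le_bound _ (Real.sqrt_nonneg _) fun f => ?_
  have h0 : 0 ≤ diagNorm k ν := integral_nonneg fun x => abs_nonneg _
  rw [← abs_norm, ← abs_of_nonneg (mul_nonneg (Real.sqrt_nonneg (diagNorm k ν)) (norm_nonneg f)),
    ← sq_le_sq, mul_pow, Real.sq_sqrt h0, ← real_inner_self_eq_norm_sq, ← inner_covOp,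
    real_inner_comm, inner_covOp_inclusion, diagNorm, ← integral_mul_const]
  refine integral_mono_of_nonneg (ae_of_all _ fun x => mul_self_nonneg _)
    ((integrable_diag hk ν).abs.mul_const _) (ae_of_all _ fun x => ?_)
  simp only [abs_of_nonneg (kernel_diag_nonneg hH x), ← sq]
  exact sq_apply_le hH f x

lemma norm_covOp_inclusion_le : ‖covOp (inclusion hk hH ν)‖ ≤ diagNorm k ν := by
  have h0 : 0 ≤ diagNorm k ν := integral_nonneg fun x => abs_nonneg _
  rw [covOp, ContinuousLinearMap.norm_adjoint_comp_self, ← Real.mul_self_sqrt h0]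
  have := norm_inclusion_le hk hH ν
  gcongr

/-- The covariance operator of a bounded continuous kernel is compact. -/
lemma isCompactOperator_covOp_inclusion [SecondCountableTopology α] [IsProbabilityMeasure ν] :
    IsCompactOperator (covOp (inclusion hk hH ν)) := by
  let R : α → H →L[ℝ] H := fun x => InnerProductSpace.rankOne ℝ (feature H x) (feature H x)
  have hRc : Continuous R := by
    have := continuous_feature hk hH
    exact (InnerProductSpace.rankOne ℝ (E := H) (F := H)).continuous₂.comp (this.prodMk this)
  obtain ⟨C, hC⟩ := hk.bounded
  have hRi : Integrable R ν := by
    refine Integrable.of_bound hRc.stronglyMeasurable.aestronglyMeasurable C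
      (ae_of_all _ fun x => ?_)
    rw [InnerProductSpace.norm_rankOne, ← sq, norm_feature_sq hH]
    exact (le_abs_self _).trans (hC x x)
  -- The covariance is a mean of rank-one operators, and the compact operators form a closed convex
  -- set, which contains such means.
  have hmem : ∫ x, R x ∂ν ∈ {A : H →L[ℝ] H | IsCompactOperator A} :=
    (compactOperator (RingHom.id ℝ) H H).convex.integral_mem isClosed_setOfPred_isCompactOperator
      (ae_of_all _ fun x => isCompactOperator_rankOne _ _) hRi
  have heq : ∫ x, R x ∂ν = covOp (inclusion hk hH ν) := by
    ext1 v
    refine ext_inner_left ℝ fun u => ?_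
    rw [ContinuousLinearMap.integral_apply hRi, inner_covOp_inclusion,
      ← integral_inner (hRi.apply_continuousLinearMap v)]
    refine integral_congr_ae (ae_of_all _ fun x => ?_)
    simp only [R, InnerProductSpace.rankOne_apply, real_inner_smul_right, feature_inner,
      real_inner_comm v]
    ring
  rwa [heq] at hmem

end Inclusion

/-! ### Population operators, the good event and its probability. -/

section Koopman

lemma integral_compProd_fst {α β : Type*} [TopologicalSpace α] [MeasurableSpace α] [BorelSpace α]
    [MeasurableSpace β] (ν : Measure α) [SFinite ν] (κ : Kernel α β) [IsMarkovKernel κ]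
    {g : α → ℝ} (hg : Continuous g) : ∫ z, g z.1 ∂(ν ⊗ₘ κ) = ∫ x, g x ∂ν := by
  conv_rhs => rw [← Measure.fst_compProd ν κ]
  rw [Measure.fst, integral_map measurable_fst.aemeasurable hg.measurable.aestronglyMeasurable]

variable {α β : Type*} [TopologicalSpace α] [MeasurableSpace α] [BorelSpace α]
  [SecondCountableTopology α] [TopologicalSpace β] [MeasurableSpace β] [BorelSpace β]
  {HX HY : Type*}
  [NormedAddCommGroup HX] [InnerProductSpace ℝ HX] [CompleteSpace HX] [RKHS ℝ HX α ℝ]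
  [NormedAddCommGroup HY] [InnerProductSpace ℝ HY] [CompleteSpace HY] [RKHS ℝ HY β ℝ]
  {kX : α → α → ℝ} (hkX : IsBoundedContinuousKernel kX) (hHX : IsRKHSOf HX kX)
  {kY : β → β → ℝ} (hkY : IsBoundedContinuousKernel kY) (hHY : IsRKHSOf HY kY)
  (ν : Measure α) [IsProbabilityMeasure ν] (κ : Kernel α β) [IsMarkovKernel κ]

/-- This identifies `S^*K` as the expectation of `Φ(x) ⊗ Φ(y)` under the joint law, that is, as the
mean of the empirical cross-covariance. -/
lemma inner_adjoint_inclusion_koopman (u : HX) (v : HY) :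
    inner ℝ u (((inclusion hkX hHX ν).adjoint ∘L koopman hkY hHY κ ν) v) =
      ∫ z, u z.1 * v z.2 ∂(ν ⊗ₘ κ) := by
  obtain ⟨C, -, hC⟩ := exists_bound hkX hHX
  obtain ⟨C', -, hC'⟩ := exists_bound hkY hHY
  have hu := continuous_coe hkX hHX u
  have hv := continuous_coe hkY hHY v
  have hi : Integrable (fun z : α × β => u z.1 * v z.2) (ν ⊗ₘ κ) := by
    refine Integrable.of_bound (Measurable.aestronglyMeasurable
      ((hu.measurable.comp measurable_fst).mul (hv.measurable.comp measurable_snd)))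
      (C * ‖u‖ * (C' * ‖v‖)) (ae_of_all _ fun z => ?_)
    rw [norm_mul]
    exact mul_le_mul (hC _ _) (hC' _ _) (norm_nonneg _) ((norm_nonneg _).trans (hC u z.1))
  rw [ContinuousLinearMap.comp_apply, ContinuousLinearMap.adjoint_inner_right, inner_inclusion,
    Measure.integral_compProd hi]
  refine integral_congr_ae ?_
  filter_upwards [(memLp_koopman hkY hHY κ ν v).coeFn_toLp] with x hx
  rw [integral_const_mul]
  congr 1

/-- On the good event, an estimator exists and every estimator has a small error. -/
lemma estimator_error_le {M N NY ε η : ℝ} (hM : 0 ≤ M) (hkYM : ∀ y, kY y y ≤ M)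
    (hN : N = diagNorm kX ν) (hN0 : 0 < N) (hNY : N ≤ NY) {r : ℕ} (hr : 1 ≤ r)
    (hη : 0 ≤ η) (hηN : η ≤ N) (hηε : η ≤ ε) (hηM : η * √(2 * N * M) ≤ ε * N)
    (hgap : ε < gap (eigVal (covOp (inclusion hkX hHX ν))) r)
    {m : ℕ} {z : Fin m → α × β}
    (h1 : ‖covOp (inclusion hkX hHX ν) - empCov HX z‖ ≤ η)
    (h2 : ‖(inclusion hkX hHX ν).adjoint ∘L koopman hkY hHY κ ν - empCross HX HY z‖ ≤ η) :
    (∃ Khat : HY →L[ℝ] HX, IsKEDMDEstimator z r Khat) ∧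
      ∀ Khat : HY →L[ℝ] HX, IsKEDMDEstimator z r Khat →
        ‖mercerProj (inclusion hkX hHX ν) r ∘L koopman hkY hHY κ ν
          - inclusion hkX hHX ν ∘L Khat‖ ≤
          errorConst (eigVal (covOp (inclusion hkX hHX ν))) r N NY * ε := by
  set S := inclusion hkX hHX ν with hS
  have hc : IsCompactOperator (covOp S) := isCompactOperator_covOp_inclusion hkX hHX ν
  have hT := isPositive_covOp S
  set d := gap (eigVal (covOp S)) r with hd
  have hε0 : 0 ≤ ε := hη.trans hηε
  have hd0 : 0 < d := hε0.trans_lt hgap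
  have hg : ∀ j : Fin r, 2 * d ≤ eigVal (covOp S) (j + 1) - eigVal (covOp S) (j + 2) := fun j => by
    have : d ≤ (eigVal (covOp S) (j + 1) - eigVal (covOp S) (j + 2)) / 2 :=
      ciInf_le (Set.finite_range _).bddBelow j
    linarith
  have hlr : 2 * d ≤ eigVal (covOp S) r := by
    have h := hg ⟨r - 1, by omega⟩
    have h' := eigVal_nonneg (covOp S) (r - 1 + 2)
    simp only [Nat.sub_add_cancel hr] at h
    linarith
  have hr0 : 0 < eigVal (covOp S) r := by linarith
  have hT' := isPositive_empCov (HX := HX) z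
  have hc' := isCompactOperator_empCov (HX := HX) z
  -- By Weyl the empirical eigenvalue is at least `2d - η > 0`, so the data provide a full leading
  -- system and an estimator exists.
  have hpos' : 0 < eigVal (empCov HX z) r := by
    have := (abs_le.1 ((abs_eigVal_sub_le hT hT' hc hc' hr).trans h1)).2
    linarith
  refine ⟨?_, ?_⟩
  · obtain ⟨f, hf⟩ := exists_isLeadingEigensystem hT' hc' r (Or.inr hpos')
    exact ⟨_, _, ⟨f, hf, rfl⟩, rfl⟩
  · rintro _ ⟨A, hA, rfl⟩
    obtain ⟨f, hf⟩ := exists_isLeadingEigensystem hT hc r (Or.inr hr0)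
    refine (hf.norm_mercerProj_comp_sub_le hc hr (koopman hkY hHY κ ν) hT' hc' hA
      (empCross HX HY z) hd0 (hηε.trans hgap.le) h1 h2 hg).trans ?_
    have hcov : ‖empCov HX z‖ ≤ 2 * N := by
      have h3 := norm_covOp_inclusion_le hkX hHX ν
      have h4 := norm_sub_norm_le (empCov HX z) (covOp S)
      rw [norm_sub_rev] at h4
      rw [← hS, ← hN] at h3
      linarith
    have hcross : ‖empCross HX HY z‖ ≤ √(2 * N * M) := by
      refine (norm_empCross_le z hM fun v y => ?_).trans (by gcongr)
      exact (sq_apply_le hHY v y).trans (by gcongr; exact hkYM y)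
    -- The reduced accuracy `η` pays for the supremum `M` hidden in the cross-covariance, leaving
    -- only `N ≤ 1 + NY`.
    have hprod : η * ‖empCross HX HY z‖ ≤ (1 + NY) * ε := by
      calc η * ‖empCross HX HY z‖ ≤ η * √(2 * N * M) := by gcongr
        _ ≤ ε * N := hηM
        _ ≤ _ := by nlinarith
    have hSn : ‖S‖ ≤ √N := by rw [hN]; exact norm_inclusion_le hkX hHX ν
    rw [errorConst, add_mul, ← hd]
    refine add_le_add (by gcongr) ?_
    calc ‖S‖ * ((r + 1) / (d * eigVal (covOp S) r) * η) * ‖empCross HX HY z‖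
        = ‖S‖ * ((r + 1) / (d * eigVal (covOp S) r)) * (η * ‖empCross HX HY z‖) := by ring
      _ ≤ √N * ((r + 1) / (d * eigVal (covOp S) r)) * ((1 + NY) * ε) := by gcongr
      _ = _ := by ring

/-- With high probability, both empirical covariance operators are close to their means. The
deviation involves the `L¹`-norm of the kernel diagonal, by Bernstein's inequality. -/
lemma exists_measurableSet_empirical_close [SecondCountableTopology β] {M N η δ : ℝ} (hM : 0 < M)
    (hkXM : ∀ x, kX x x ≤ M) (hkYM : ∀ y, kY y y ≤ M) (hN : N = diagNorm kX ν) (hN0 : 0 < N)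
    (hη : 0 ≤ η) (hηN : η ≤ N) (hδ : 0 < δ) {m : ℕ} (hm1 : 1 ≤ m)
    (hm : 4 * (M * N) * Real.log (4 / δ) ≤ m * η ^ 2) :
    ∃ G : Set (Fin m → α × β), MeasurableSet G ∧
      1 - δ ≤ (Measure.pi fun _ : Fin m => ν ⊗ₘ κ).real G ∧
      ∀ z ∈ G, ‖covOp (inclusion hkX hHX ν) - empCov HX z‖ ≤ η ∧
        ‖(inclusion hkX hHX ν).adjoint ∘L koopman hkY hHY κ ν - empCross HX HY z‖ ≤ η := by
  have hp : StronglyMeasurable fun z : α × β => feature HX z.1 :=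
    (continuous_feature hkX hHX).stronglyMeasurable.comp_measurable measurable_fst
  have hq : StronglyMeasurable fun z : α × β => feature HY z.2 :=
    (continuous_feature hkY hHY).stronglyMeasurable.comp_measurable measurable_snd
  have hpn : ∀ z : α × β, ‖feature HX z.1‖ ^ 2 ≤ M := fun z => by
    rw [norm_feature_sq hHX]; exact hkXM _
  have hqn : ∀ z : α × β, ‖feature HY z.2‖ ^ 2 ≤ M := fun z => by
    rw [norm_feature_sq hHY]; exact hkYM _
  have hdiag : ∫ z : α × β, kX z.1 z.1 ∂(ν ⊗ₘ κ) = N := by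
    have hc : Continuous fun x => kX x x := hkX.continuous.comp (continuous_id.prodMk continuous_id)
    rw [integral_compProd_fst ν κ hc, hN, diagNorm]
    simp only [abs_of_nonneg (kernel_diag_nonneg hHX _)]
  have hdi : Integrable (fun z : α × β => kX z.1 z.1) (ν ⊗ₘ κ) :=
    Integrable.of_integral_ne_zero (by rw [hdiag]; exact hN0.ne')
  -- In the second moment one feature is bounded by `M` and the other is integrated to `N`. Used
  -- with the features of `x` and of `y` in the role of `q'`.
  have key : ∀ q' : α × β → ℝ, (∀ z, 0 ≤ q' z) → (∀ z, q' z ^ 2 ≤ M) →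
      (∀ z : α × β, ‖feature HX z.1‖ * q' z ≤ M) ∧
      ∫ z : α × β, (‖feature HX z.1‖ * q' z) ^ 2 ∂(ν ⊗ₘ κ) ≤ M * N := fun q' hq0 hq' => by
    refine ⟨fun z => ?_, ?_⟩
    · nlinarith [hpn z, hq' z, sq_nonneg (‖feature HX z.1‖ - q' z)]
    · rw [← hdiag, ← integral_const_mul]
      refine integral_mono_of_nonneg (ae_of_all _ fun z => sq_nonneg _) (hdi.const_mul M)
        (ae_of_all _ fun z => ?_)
      simp only
      rw [mul_pow, norm_feature_sq hHX, mul_comm]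
      exact mul_le_mul_of_nonneg_right (hq' z) (kernel_diag_nonneg hHX _)
  obtain ⟨h1, h2⟩ := key (fun z => ‖feature HX z.1‖) (fun z => norm_nonneg _) hpn
  obtain ⟨h3, h4⟩ := key (fun z => ‖feature HY z.2‖) (fun z => norm_nonneg _) hqn
  obtain ⟨G₁, hG₁, hP₁, hC₁⟩ := exists_measurableSet_norm_sub_empirical_le
    (π := ν ⊗ₘ κ) hp hp hM hN0 h1 h2 (B := covOp (inclusion hkX hHX ν)) (fun u v => by
      have hc : Continuous fun x => u x * v x :=
        (continuous_coe hkX hHX u).mul (continuous_coe hkX hHX v)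
      rw [inner_covOp_inclusion, ← integral_compProd_fst ν κ hc]
      simp only [real_inner_comm u, real_inner_comm v, feature_inner]) hη hηN hm1
  obtain ⟨G₂, hG₂, hP₂, hC₂⟩ := exists_measurableSet_norm_sub_empirical_le
    (π := ν ⊗ₘ κ) hp hq hM hN0 h3 h4
    (B := (inclusion hkX hHX ν).adjoint ∘L koopman hkY hHY κ ν) (fun u v => by
      rw [inner_adjoint_inclusion_koopman]
      simp only [real_inner_comm u, real_inner_comm v, feature_inner]) hη hηN hm1
  -- Each of the two events may fail with probability `δ/2`, which accounts for `log (4/δ)`.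
  have htail : 2 * Real.exp (-(m * η ^ 2 / (4 * (M * N)))) ≤ δ / 2 := by
    have h5 : Real.log (4 / δ) ≤ m * η ^ 2 / (4 * (M * N)) := by
      rw [le_div_iff₀ (by positivity)]; linarith
    have h6 : Real.exp (-(m * η ^ 2 / (4 * (M * N)))) ≤ δ / 4 := by
      calc _ ≤ Real.exp (-Real.log (4 / δ)) := Real.exp_le_exp.2 (neg_le_neg h5)
        _ = δ / 4 := by rw [Real.exp_neg, Real.exp_log (by positivity), inv_div]
    linarith
  refine ⟨G₁ ∩ G₂, hG₁.inter hG₂, ?_, fun z hz => ⟨hC₁ z hz.1, hC₂ z hz.2⟩⟩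
  have h7 := probReal_compl_eq_one_sub (μ := Measure.pi fun _ : Fin m => ν ⊗ₘ κ) (hG₁.inter hG₂)
  have h8 := measureReal_union_le (μ := Measure.pi fun _ : Fin m => ν ⊗ₘ κ) G₁ᶜ G₂ᶜ
  rw [← compl_inter] at h8
  linarith

end Koopman

/-! ### Bounded factorization by the closed graph theorem. -/

section Factorization

variable {E F G : Type*} [NormedAddCommGroup E] [InnerProductSpace ℝ E] [CompleteSpace E]
  [NormedAddCommGroup F] [InnerProductSpace ℝ F]
  [NormedAddCommGroup G] [InnerProductSpace ℝ G] [CompleteSpace G]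

/-- An operator with values in the range of an injective operator factors through it. -/
lemma exists_comp_eq {S : E →L[ℝ] F} (hS : Function.Injective S) (K : G →L[ℝ] F)
    (h : ∀ x, ∃ y, S y = K x) : ∃ A : G →L[ℝ] E, S ∘L A = K := by
  choose a ha using h
  let A : G →ₗ[ℝ] E :=
    { toFun := a
      map_add' := fun x y => hS (by rw [ha, map_add, map_add, ha, ha])
      map_smul' := fun c x => hS (by rw [ha, map_smul, RingHom.id_apply, map_smul, ha]) }
  -- The graph of `A` is closed because `S` and `K` are continuous and `S` is injective.
  have hcont : Continuous A := A.continuous_of_seq_closed_graph fun u x y hu hAu => by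
    refine hS ?_
    have h1 : Tendsto (fun n => S (A (u n))) atTop (𝓝 (S y)) := (S.continuous.tendsto y).comp hAu
    have h2 : Tendsto (fun n => K (u n)) atTop (𝓝 (K x)) := (K.continuous.tendsto x).comp hu
    have h3 : (fun n => S (A (u n))) = fun n => K (u n) := funext fun n => ha (u n)
    rw [h3] at h1
    exact (tendsto_nhds_unique h1 h2).trans (ha x).symm
  exact ⟨⟨A, hcont⟩, ContinuousLinearMap.ext ha⟩

end Factorization

/-! ### Passing from the ambient space to the state sets. -/

section StateSets

variable {d : ℕ} {𝒳 𝒴 : Set (Euc d)}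

lemma measurableEmbedding_inclusion (h : 𝒳 ⊆ 𝒴) (h𝒳 : MeasurableSet 𝒳) :
    MeasurableEmbedding (Set.inclusion h) := by
  refine (IsEmbedding.inclusion h).measurableEmbedding ?_
  rw [Set.range_inclusion]
  exact measurable_subtype_coe h𝒳

lemma isProbabilityMeasure_restrictMeasure (h : 𝒳 ⊆ 𝒴) (h𝒳 : MeasurableSet 𝒳) {μ : Measure 𝒴}
    (hμ : μ (Subtype.val ⁻¹' 𝒳) = 1) : IsProbabilityMeasure (restrictMeasure h μ) := by
  constructor
  rw [restrictMeasure, (measurableEmbedding_inclusion h h𝒳).comap_apply, image_univ,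
    Set.range_inclusion]
  exact hμ

lemma isMarkovKernel_restrictKernel (h𝒴 : IsClosed 𝒴) {ρ : Kernel (Euc d) (Euc d)}
    (h : ∀ x ∈ 𝒳, ρ x 𝒴 = 1) : IsMarkovKernel (restrictKernel 𝒳 h𝒴 ρ) := by
  refine ⟨fun x => ⟨?_⟩⟩
  rw [restrictKernel, Kernel.comapRight_apply' _ _ _ MeasurableSet.univ, image_univ,
    Subtype.range_coe, Kernel.comap_apply]
  exact h x x.2

lemma diagNorm_restrict_le (h : 𝒳 ⊆ 𝒴) (h𝒳 : MeasurableSet 𝒳) {μ : Measure 𝒴} [IsFiniteMeasure μ]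
    {k : 𝒴 → 𝒴 → ℝ} (hk : IsBoundedContinuousKernel k) :
    diagNorm (restrictFun h k) (restrictMeasure h μ) ≤ diagNorm k μ := by
  have he := measurableEmbedding_inclusion h h𝒳
  calc diagNorm (restrictFun h k) (restrictMeasure h μ)
      = ∫ y, |k y y| ∂(Measure.map (Set.inclusion h) (restrictMeasure h μ)) :=
        (he.integral_map fun y => |k y y|).symm
    _ = ∫ y in Set.range (Set.inclusion h), |k y y| ∂μ := by rw [restrictMeasure, he.map_comap]
    _ ≤ _ := setIntegral_le_integral (integrable_diag hk μ).abs (ae_of_all _ fun y => abs_nonneg _)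

lemma kernel_le_kernelSup {α : Type*} [TopologicalSpace α] {k : α → α → ℝ}
    (hk : IsBoundedContinuousKernel k) (x y : α) : k x y ≤ kernelSup k := by
  obtain ⟨C, hC⟩ := hk.bounded
  exact (le_abs_self _).trans
    (le_ciSup (f := fun p : α × α => |k p.1 p.2|) ⟨C, by rintro _ ⟨p, rfl⟩; exact hC _ _⟩ (x, y))

end StateSets

/-- Transfer of an event from the product law to i.i.d. random variables. -/
lemma holdsWithProbGE_of_iIndepFun {Ω Z : Type*} [MeasurableSpace Ω] [MeasurableSpace Z]
    {P : Measure Ω} [IsProbabilityMeasure P] {π : Measure Z} [IsProbabilityMeasure π] {m : ℕ}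
    {z : Fin m → Ω → Z} (hz : ∀ i, Measurable (z i)) (hind : iIndepFun z P)
    (hlaw : ∀ i, P.map (z i) = π) {G : Set (Fin m → Z)} (hG : MeasurableSet G) {p : ℝ}
    (hp : p ≤ (Measure.pi fun _ : Fin m => π).real G) {Q : Ω → Prop}
    (hQ : ∀ ω, (fun i => z i ω) ∈ G → Q ω) : HoldsWithProbGE P p Q := by
  have hmeas : Measurable fun ω i => z i ω := measurable_pi_lambda _ hz
  refine ⟨(fun ω i => z i ω) ⁻¹' G, hmeas hG, ?_, hQ⟩
  have hmap := (iIndepFun_iff_map_fun_eq_pi_map fun i => (hz i).aemeasurable).1 hind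
  simp only [hlaw] at hmap
  rw [← Measure.map_apply hmeas hG, hmap]
  exact ENNReal.ofReal_le_of_le_toReal hp

end KernelEDMD

theorem theorem4p2 {d : ℕ}
    (b : KernelEDMD.Euc d → KernelEDMD.Euc d)
    (σ : KernelEDMD.Euc d → KernelEDMD.Euc d →L[ℝ] KernelEDMD.Euc d)
    (hb : ∃ c, LipschitzWith c b) (hσ : ∃ c, LipschitzWith c σ)
    (ρ : ℝ≥0 → Kernel (KernelEDMD.Euc d) (KernelEDMD.Euc d)) [∀ t, IsMarkovKernel (ρ t)]
    (hρ : KernelEDMD.IsTransitionKernel b σ ρ)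
    -- the sets `𝒳 = closure D ⊆ 𝒴`
    (D 𝒴 : Set (KernelEDMD.Euc d)) (hDopen : IsOpen D) (hDbdd : Bornology.IsBounded D)
    (hDconn : IsConnected D) (h𝒴 : IsClosed 𝒴) (hsub : closure D ⊆ 𝒴)
    (hstay : ∀ t, ∀ x ∈ closure D, ρ t x 𝒴 = 1)
    -- the time horizon and the measure
    (T : ℝ≥0) (hT : 0 < T)
    (μ : Measure 𝒴) [IsFiniteMeasure μ] (hμ : μ (Subtype.val ⁻¹' closure D) = 1)
    (L : ℝ≥0)
    (hL : ∀ t ≤ T, ∀ A : Set 𝒴, MeasurableSet A →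
      ∫⁻ x, KernelEDMD.restrictKernel (closure D) h𝒴 (ρ t) x A
        ∂(KernelEDMD.restrictMeasure hsub μ) ≤ L * μ A)
    -- the kernel and its reproducing kernel Hilbert spaces on `𝒴` and on `𝒳`
    (k : 𝒴 → 𝒴 → ℝ) (hk : KernelEDMD.IsBoundedContinuousKernel k)
    {HY : Type*} [NormedAddCommGroup HY] [InnerProductSpace ℝ HY] [CompleteSpace HY]
    [RKHS ℝ HY 𝒴 ℝ] (hHY : KernelEDMD.IsRKHSOf HY k)
    {HX : Type*} [NormedAddCommGroup HX] [InnerProductSpace ℝ HX] [CompleteSpace HX]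
    [RKHS ℝ HX (closure D) ℝ] (hHX : KernelEDMD.IsRKHSOf HX (KernelEDMD.restrictFun hsub k))
    -- the compatibility assumptions
    (hC1 : ∀ ψ : 𝒴 → ℝ, MemLp ψ 2 μ →
      ∫ x, ∫ y, k x y * ψ x * ψ y ∂μ ∂μ = 0 → ψ =ᵐ[μ] 0)
    (hC2 : ∀ ψ : HY, (∀ᵐ y ∂μ, ψ y = 0) → ψ = 0)
    (hC2X : ∀ ψ : HX, (∀ᵐ x ∂(KernelEDMD.restrictMeasure hsub μ), ψ x = 0) → ψ = 0)
    (t : ℝ≥0) (ht : t ≤ T)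
    -- the inclusion operator, the Koopman operator and the Mercer eigenvalues
    (S : HX →L[ℝ] Lp ℝ 2 (KernelEDMD.restrictMeasure hsub μ))
    (hS : S = KernelEDMD.inclusion (hk.restrict hsub) hHX (KernelEDMD.restrictMeasure hsub μ))
    (K : HY →L[ℝ] Lp ℝ 2 (KernelEDMD.restrictMeasure hsub μ))
    (hK : K = KernelEDMD.koopman hk hHY (KernelEDMD.restrictKernel (closure D) h𝒴 (ρ t))
      (KernelEDMD.restrictMeasure hsub μ))
    (ev : ℕ → ℝ) (hev : ev = KernelEDMD.eigVal (KernelEDMD.covOp S))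
    (r : ℕ) (hr : 1 ≤ r) (hsimple : ∀ j, 1 ≤ j → j ≤ r → ev (j + 1) < ev j)
    (c : ℝ) (hc : c = KernelEDMD.errorConst ev r
      (KernelEDMD.diagNorm (KernelEDMD.restrictFun hsub k) (KernelEDMD.restrictMeasure hsub μ))
      (KernelEDMD.diagNorm k μ))
    (ε δ : ℝ) (hε0 : 0 < ε) (hε : ε < KernelEDMD.gap ev r) (hδ0 : 0 < δ) (hδ1 : δ < 1)
    (m : ℕ) (hm : max (r : ℝ) (8 * KernelEDMD.kernelSup k ^ 2 * Real.log (4 / δ) / ε ^ 2) ≤ m)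
    -- the i.i.d. data `z i = (x_i, y_i)`
    {Ω : Type*} [MeasurableSpace Ω] (P : Measure Ω) [IsProbabilityMeasure P]
    (z : Fin m → Ω → closure D × 𝒴) (hzmeas : ∀ i, Measurable (z i)) (hzindep : iIndepFun z P)
    (hzlaw : ∀ i, P.map (z i) = (KernelEDMD.restrictMeasure hsub μ) ⊗ₘ
      (KernelEDMD.restrictKernel (closure D) h𝒴 (ρ t))) :
    KernelEDMD.HoldsWithProbGE P (1 - δ) (fun ω =>
      (∃ Khat : HY →L[ℝ] HX, KernelEDMD.IsKEDMDEstimator (fun i => z i ω) r Khat) ∧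
      ∀ Khat : HY →L[ℝ] HX, KernelEDMD.IsKEDMDEstimator (fun i => z i ω) r Khat →
        ‖KernelEDMD.mercerProj S r ∘L K - S ∘L Khat‖ ≤ c * ε) ∧
    ((∀ ψ : HY, ∃ η : HX, S η = K ψ) →
      ∃ KXY : HY →L[ℝ] HX, S ∘L KXY = K ∧
        KernelEDMD.HoldsWithProbGE P (1 - δ) (fun ω =>
          (∃ Khat : HY →L[ℝ] HX, KernelEDMD.IsKEDMDEstimator (fun i => z i ω) r Khat) ∧
          ∀ Khat : HY →L[ℝ] HX, KernelEDMD.IsKEDMDEstimator (fun i => z i ω) r Khat →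
            ‖K - S ∘L Khat‖ ≤ √(ev (r + 1)) * ‖KXY‖ + c * ε)) := by
  have hDm : MeasurableSet (closure D) := isClosed_closure.measurableSet
  have : IsProbabilityMeasure (KernelEDMD.restrictMeasure hsub μ) :=
    KernelEDMD.isProbabilityMeasure_restrictMeasure hsub hDm hμ
  have : IsMarkovKernel (KernelEDMD.restrictKernel (closure D) h𝒴 (ρ t)) :=
    KernelEDMD.isMarkovKernel_restrictKernel h𝒴 (hstay t)
  have hkX := hk.restrict hsub
  have hcomp : IsCompactOperator (KernelEDMD.covOp S) := by
    rw [hS]; exact KernelEDMD.isCompactOperator_covOp_inclusion hkX hHX _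
  have hT := KernelEDMD.isPositive_covOp S
  set M := KernelEDMD.kernelSup k with hM
  set N := KernelEDMD.diagNorm (KernelEDMD.restrictFun hsub k)
    (KernelEDMD.restrictMeasure hsub μ) with hN
  have hkM : ∀ y, k y y ≤ M := fun y => KernelEDMD.kernel_le_kernelSup hk y y
  have hkXM : ∀ x, KernelEDMD.restrictFun hsub k x x ≤ M := fun x => hkM _
  have hNM : N ≤ M := by
    calc N ≤ ∫ _x, M ∂(KernelEDMD.restrictMeasure hsub μ) :=
          integral_mono_of_nonneg (ae_of_all _ fun x => abs_nonneg _)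
          (integrable_const M) (ae_of_all _ fun x => by
            simp only [abs_of_nonneg (KernelEDMD.kernel_diag_nonneg hHX x)]
            exact hkXM x)
      _ = M := by simp
  have hNY : N ≤ KernelEDMD.diagNorm k μ := KernelEDMD.diagNorm_restrict_le hsub hDm hk
  have hevN : ev 1 ≤ N := by
    rw [hev]
    refine (KernelEDMD.eigVal_le_norm hT le_rfl).trans ?_
    rw [hS]
    exact KernelEDMD.norm_covOp_inclusion_le hkX hHX _
  have hgap1 : KernelEDMD.gap ev r ≤ (ev 1 - ev 2) / 2 :=
    ciInf_le (f := fun j : Fin r => (ev (j + 1) - ev (j + 2)) / 2)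
      (Set.finite_range _).bddBelow ⟨0, hr⟩
  have hev2 : 0 ≤ ev 2 := by rw [hev]; exact KernelEDMD.eigVal_nonneg _ _
  -- `ε` is below half of `λ₁ ≤ N`; this keeps the deviation in the Gaussian regime of Bernstein's
  -- inequality and shows `N > 0`.
  have hεN : ε ≤ N := by linarith
  have hN0 : 0 < N := hε0.trans_le hεN
  have hM0 : 0 < M := hN0.trans_le hNM
  have hm1 : 1 ≤ m := hr.trans (by exact_mod_cast (le_max_left _ _).trans hm)
  have hm2 : 8 * M ^ 2 * Real.log (4 / δ) ≤ m * ε ^ 2 :=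
    (div_le_iff₀ (by positivity)).1 ((le_max_right _ _).trans hm)
  -- Chosen so that the Bernstein condition `4MN log(4/δ) ≤ m η²` follows from `8M² log(4/δ) ≤ m
  -- ε²`, and so that `η √(2NM) = εN`.
  set η := ε * √(N / (2 * M)) with hη
  have hη0 : 0 ≤ η := by positivity
  have hηε : η ≤ ε := by
    refine mul_le_of_le_one_right hε0.le (Real.sqrt_le_one.2 ?_)
    rw [div_le_one (by positivity)]
    linarith
  have hηm : 4 * (M * N) * Real.log (4 / δ) ≤ m * η ^ 2 := by
    rw [hη, mul_pow, Real.sq_sqrt (by positivity)]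
    calc 4 * (M * N) * Real.log (4 / δ)
        = 8 * M ^ 2 * Real.log (4 / δ) * (N / (2 * M)) := by field_simp; ring
      _ ≤ m * ε ^ 2 * (N / (2 * M)) := by gcongr
      _ = _ := by ring
  have hηM : η * √(2 * N * M) ≤ ε * N := by
    rw [hη, mul_assoc, ← Real.sqrt_mul (by positivity)]
    have : N / (2 * M) * (2 * N * M) = N ^ 2 := by field_simp
    rw [this, Real.sqrt_sq hN0.le]
  obtain ⟨G, hG, hPG, hGood⟩ := KernelEDMD.exists_measurableSet_empirical_close hkX hHX hk hHY
    (KernelEDMD.restrictMeasure hsub μ) (KernelEDMD.restrictKernel (closure D) h𝒴 (ρ t))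
    hM0 hkXM hkM hN hN0 hη0 (hηε.trans hεN) hδ0 hm1 hηm
  have hmain : ∀ z ∈ G, (∃ Khat : HY →L[ℝ] HX, KernelEDMD.IsKEDMDEstimator z r Khat) ∧
      ∀ Khat : HY →L[ℝ] HX, KernelEDMD.IsKEDMDEstimator z r Khat →
        ‖KernelEDMD.mercerProj S r ∘L K - S ∘L Khat‖ ≤ c * ε := by
    intro z hz
    rw [hc, hK, hev, hS]
    rw [hev, hS] at hε
    exact KernelEDMD.estimator_error_le hkX hHX hk hHY _ _ hM0.le hkM hN hN0 hNY hr hη0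
      (hηε.trans hεN) hηε hηM hε (hGood z hz).1 (hGood z hz).2
  refine ⟨KernelEDMD.holdsWithProbGE_of_iIndepFun hzmeas hzindep hzlaw hG hPG
    fun ω hω => hmain _ hω, fun hrange => ?_⟩
  have hinj : Function.Injective S := by
    rw [injective_iff_map_eq_zero]
    intro ψ hψ
    refine hC2X ψ ?_
    have h1 := KernelEDMD.coeFn_inclusion hkX hHX (KernelEDMD.restrictMeasure hsub μ) ψ
    rw [← hS, hψ] at h1
    filter_upwards [h1, Lp.coeFn_zero ℝ 2 (KernelEDMD.restrictMeasure hsub μ)] with x hx hx0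
    rw [← hx, hx0, Pi.zero_apply]
  obtain ⟨KXY, hKXY⟩ := KernelEDMD.exists_comp_eq hinj K hrange
  refine ⟨KXY, hKXY, KernelEDMD.holdsWithProbGE_of_iIndepFun hzmeas hzindep hzlaw hG hPG
    fun ω hω => ⟨(hmain _ hω).1, fun Khat hKhat => ?_⟩⟩
  have hlt := hsimple r hr le_rfl
  have hr0 : 0 < ev r := lt_of_le_of_lt (by rw [hev]; exact KernelEDMD.eigVal_nonneg _ _) hlt
  rw [hev] at hlt hr0
  obtain ⟨f, hf⟩ := KernelEDMD.exists_isLeadingEigensystem hT hcomp r (Or.inr hr0)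
  -- Bias plus estimation error. The second term is the one already bounded, so the same event
  -- serves both claims.
  have hsplit : K - S ∘L Khat = (S - KernelEDMD.mercerProj S r ∘L S) ∘L KXY +
      (KernelEDMD.mercerProj S r ∘L K - S ∘L Khat) := by
    rw [← hKXY]
    ext1 x
    simp only [_root_.sub_apply, _root_.add_apply, ContinuousLinearMap.comp_apply]
    abel
  rw [hsplit]
  refine (norm_add_le _ _).trans (add_le_add ?_ ((hmain _ hω).2 Khat hKhat))
  refine (ContinuousLinearMap.opNorm_comp_le _ _).trans ?_
  rw [hev]
  exact mul_le_mul_of_nonneg_right (hf.norm_sub_mercerProj_comp_le hcomp hlt) (norm_nonneg _)
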